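/- Let $m,n>1$ be integers, let $\mathbf S^m\subset\mathbb R^{m+1}$ be the unit sphere, and let $M=\mathbb R^n\times\mathbf S^m$ carry the Riemannian product metric. For a hypersurface $\Sigma\subset M$ with smooth unit normal field $N$ let $B(v,w)=-\langle\nabla_vN,w\rangle$ be its second fundamental form; its mean curvature with respect to $N$ is the trace of $B$ (the sum of the principal curvatures). Its index form is $$Q_\Sigma(u)=\int_\Sigma\left(\|\nabla u\|^2-(\mathrm{Ric}(N)+|B|^2)\,u^2\right)d\Sigma ,$$ where $\mathrm{Ric}(N)=\mathrm{Ric}(N,N)$ is the Ricci curvature of $M$ in the direction $N$. A hypersurface $\Sigma$ of constant mean curvature is called stable if $Q_\Sigma(u)\ge 0$ for all smooth functions $u:\Sigma\to\mathbb R$ with compact support and $\int_\Sigma u\,d\Sigma=0$, and unstable otherwise. For $r>0$ let $\mathbf S^{n-1}(r)\subset\mathbb R^n$ be the sphere of radius $r$ centred at the origin. For every $h>0$ the hypersurface $$\Sigma_h^1=\mathbf S^{n-1}\left(\tfrac{n-1}{h}\right)\times\mathbf S^m\subset\mathbb R^n\times\mathbf S^m$$ has constant mean curvature $h$ (with respect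 to a suitable choice of unit normal), and it is unstable if and only if $h>\sqrt{m(n-1)}$. Equivalently, for every $r>0$ the hypersurface $\mathbf S^{n-1}(r)\times\mathbf S^m\subset\mathbb R^n\times\mathbf S^m$, which has constant mean curvature $(n-1)/r$, is unstable if and only if $r<\sqrt{n-1}/\sqrt m$. -/

import Mathlib

open MeasureTheory
open scoped ContDiff

noncomputable section

namespace EuclideanSubmanifold

/-! Riemannian geometry of smooth submanifolds `M` of a finite-dimensional Euclidean space `E`,
with the metric induced from `E`. Functions and vector fields on `M` are represented by maps
defined on `E` of which only the values on `M` matter. For a function `f` that is smooth on `M`,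
`fderivWithin ℝ f M p v` is the derivative of `f` at `p ∈ M` in the direction `v`, and it is
uniquely determined by `f` on `M` as soon as `v` is tangent to `M` at `p`. -/

variable {E : Type*} [NormedAddCommGroup E] [InnerProductSpace ℝ E] [FiniteDimensional ℝ E]

/-- The tangent space `T_p M`, as a linear subspace of `E`. -/
def tangentSpaceAt (M : Set E) (p : E) : Submodule ℝ E :=
  Submodule.span ℝ (tangentConeAt ℝ M p)

/-- The orthogonal projection `E → T_p M ⊆ E`. -/
def tangentProj (M : Set E) (p : E) : E →L[ℝ] E :=
  (tangentSpaceAt M p).starProjection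

/-- The gradient on `M` of a function `u` on `M`. -/
def surfaceGradient (M : Set E) (u : E → ℝ) (p : E) : E :=
  tangentProj M p (gradientWithin u M p)

/-- The Levi-Civita connection of `M`: the vector field `∇_X Y`, the tangential component of the
derivative of `Y` in the direction `X`. -/
def leviCivita (M : Set E) (X Y : E → E) (p : E) : E :=
  tangentProj M p (fderivWithin ℝ Y M p (X p))

/-- `R(X, Y) Z = ∇_X ∇_Y Z - ∇_Y ∇_X Z - ∇_[X, Y] Z` for tangent vector fields on `M`. -/
def curvatureField (M : Set E) (X Y Z : E → E) (p : E) : E :=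
  leviCivita M X (leviCivita M Y Z) p - leviCivita M Y (leviCivita M X Z) p
    - leviCivita M (VectorField.lieBracketWithin ℝ X Y M) Z p

/-- The tangent vector field on `M` given by the tangential components of a fixed vector `v`;
it extends `v` if `v` is tangent to `M` at a point. -/
def tangentExtension (M : Set E) (v : E) : E → E :=
  fun q => tangentProj M q v

/-- The Riemann curvature `R(x, y) z` at `p`, for `x y z` in `T_p M` (the curvature is tensorial,
so that the vectors may be extended to tangent fields in any way). -/
def riemannCurvature (M : Set E) (p x y z : E) : E :=
  curvatureField M (tangentExtension M x) (tangentExtension M y) (tangentExtension M z) p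

/-- The Ricci curvature `Ric(v) = Ric(v, v) = ∑ i, ⟨R(e i, v) v, e i⟩` of `M` at `p`, where `e` is
an orthonormal basis of `T_p M`. It is positive on round spheres of dimension at least `2`. -/
def ricci (M : Set E) (p v : E) : ℝ :=
  ∑ i, inner ℝ
    (riemannCurvature M p (stdOrthonormalBasis ℝ (tangentSpaceAt M p) i : E) v v)
    (stdOrthonormalBasis ℝ (tangentSpaceAt M p) i : E)

/-- `N` is a smooth unit normal vector field along the hypersurface `S` of `M`. -/
structure IsUnitNormalField (M S : Set E) (N : E → E) : Prop where
  smooth : ContDiffOn ℝ ∞ N S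
  tangent : ∀ p ∈ S, N p ∈ tangentSpaceAt M p
  normal : ∀ p ∈ S, ∀ v ∈ tangentSpaceAt S p, inner ℝ (N p) v = 0
  unit : ∀ p ∈ S, ‖N p‖ = 1

/-- The second fundamental form `B(v, w) = -⟨∇_v N, w⟩` at `p`, for `v w` in `T_p S`, of a
hypersurface `S` with unit normal field `N`. -/
def secondFundamentalForm (S : Set E) (N : E → E) (p v w : E) : ℝ :=
  - inner ℝ (fderivWithin ℝ N S p v) w

/-- The mean curvature with respect to `N`: the trace of the second fundamental form, that is the
sum of the principal curvatures. -/
def meanCurvature (S : Set E) (N : E → E) (p : E) : ℝ :=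
  ∑ i, secondFundamentalForm S N p
    (stdOrthonormalBasis ℝ (tangentSpaceAt S p) i : E)
    (stdOrthonormalBasis ℝ (tangentSpaceAt S p) i : E)

/-- The squared norm `|B|²` of the second fundamental form. -/
def normSqSecondFundamentalForm (S : Set E) (N : E → E) (p : E) : ℝ :=
  ∑ i, ∑ j, secondFundamentalForm S N p
    (stdOrthonormalBasis ℝ (tangentSpaceAt S p) i : E)
    (stdOrthonormalBasis ℝ (tangentSpaceAt S p) j : E) ^ 2

/-- The hypersurface `S` of `M` has constant mean curvature `h` with respect to some choice of
unit normal field. -/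
def HasConstantMeanCurvature (M S : Set E) (h : ℝ) : Prop :=
  ∃ N : E → E, IsUnitNormalField M S N ∧ ∀ p ∈ S, meanCurvature S N p = h

variable [MeasurableSpace E] [BorelSpace E]

/-- The volume measure of a `k`-dimensional submanifold `S`: the `k`-dimensional Hausdorff measure,
normalized so as to agree with Lebesgue measure on `ℝ^k`, restricted to `S`. -/
def volumeMeasure (k : ℕ) (S : Set E) : Measure E :=
  (Measure.euclideanHausdorffMeasure k).restrict S

/-- The index form `Q_S(u) = ∫_S (|∇u|² - (Ric(N) + |B|²) u²)` of a `k`-dimensional hypersurface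
`S` of `M` with unit normal field `N`. -/
def indexForm (k : ℕ) (M S : Set E) (N : E → E) (u : E → ℝ) : ℝ :=
  ∫ p, (‖surfaceGradient S u p‖ ^ 2
    - (ricci M p (N p) + normSqSecondFundamentalForm S N p) * u p ^ 2) ∂(volumeMeasure k S)

/-- The admissible variations: smooth functions on `S` with compact support and mean value zero. -/
structure IsAdmissible (k : ℕ) (S : Set E) (u : E → ℝ) : Prop where
  smooth : ContDiffOn ℝ ∞ u S
  compactSupport : ∃ K ⊆ S, IsCompact K ∧ ∀ p ∈ S \ K, u p = 0
  mean_zero : ∫ p, u p ∂(volumeMeasure k S) = 0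

/-- Stability of a (two-sided) `k`-dimensional hypersurface `S` of `M` of constant mean curvature.
The index form does not change when `N` is replaced by `-N`. -/
def IsStable (k : ℕ) (M S : Set E) : Prop :=
  ∀ N : E → E, IsUnitNormalField M S N → ∀ u : E → ℝ, IsAdmissible k S u → 0 ≤ indexForm k M S N u

end EuclideanSubmanifold

/-- The Euclidean space `ℝ^n × ℝ^(m+1)`. -/
abbrev AmbientSpace (n m : ℕ) : Type :=
  WithLp 2 (EuclideanSpace ℝ (Fin n) × EuclideanSpace ℝ (Fin (m + 1)))

/-- The Riemannian product `ℝ^n × S^m`, where `S^m` is the unit sphere. -/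
def euclideanTimesSphere (n m : ℕ) : Set (AmbientSpace n m) :=
  {p | ‖p.snd‖ = 1}

/-- The hypersurface `S^(n-1)(r) × S^m` of `ℝ^n × S^m`. -/
def sphereTimesSphere (n m : ℕ) (r : ℝ) : Set (AmbientSpace n m) :=
  {p | ‖p.fst‖ = r ∧ ‖p.snd‖ = 1}

end

open EuclideanSubmanifold

open Filter Topology

/-! A unit normal of S^(n-1)(r) × S^m at (x, y) is ±(x/r, 0). A constant vector of ℝ^n is a parallel
field on ℝ^n × S^m, so Ric(N) = 0, and the principal curvatures give |B|² = (n-1)/r². Hence Q(u) = ∫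
|∇u|² - (n-1)/r² ∫ u². Stability says that (n-1)/r² is at most the first nonzero eigenvalue of the
Laplacian on the product of spheres, which is min((n-1)/r², m). So instability means m < (n-1)/r²,
and both forms of the criterion are rearrangements of this.

The stable direction is the Poincaré inequality `IsInvariantOnSpheres.poincare`, obtained without
spectral theory of manifolds. The Laplacian and the squared gradient are sums over the rotation
fields x_i ∂_j - x_j ∂_i of the two blocks of coordinates. Rotations preserve the Hausdorff measure
of the hypersurface, so these fields integrate to zero and can be integrated by parts
(`integral_fderiv_flow_eq_zero`). On monomials of a given bidegree the Laplacian is a scalar minus a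
degree-lowering operator, and the scalar strictly increases with the bidegree. The triangular system
can be solved, so every polynomial is, on the spheres, a finite sum of eigenfunctions
(`exists_eq_sum_eigenpolynomials`). By Stone–Weierstrass such sums approximate u uniformly.
Gradients need not be approximated: Bessel's inequality for the Dirichlet form bounds it below by
the Fourier coefficients of u alone (`poincare_of_eigenvectors`).

For the unstable direction a coordinate function of S^m is an eigenfunction with eigenvalue m and
mean zero, and Q is negative on it once m < (n-1)/r². This needs the volume to be finite and
nonzero, which follows from Lipschitz maps between the hypersurface and pieces of its tangent
spaces. -/

/-! ### Derivatives along measure-preserving flows -/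

/-- The integral of `u ∘ φ θ` does not depend on `θ`; differentiate it at `θ = 0` under the integral
sign. The flow stays in the compact set `K`, where the derivative is bounded by a constant. -/
theorem integral_fderiv_flow_eq_zero {E : Type*} [NormedAddCommGroup E] [NormedSpace ℝ E]
    [FiniteDimensional ℝ E] [MeasurableSpace E] [BorelSpace E] {μ : Measure E} [IsFiniteMeasure μ]
    {K U : Set E} (hK : IsCompact K) (hμK : ∀ᵐ p ∂μ, p ∈ K) (hU : IsOpen U) (hKU : K ⊆ U)
    {φ : ℝ → E → E} (hφ : ∀ θ, MeasurePreserving (φ θ) μ μ) (hφK : ∀ θ, Set.MapsTo (φ θ) K K)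
    (hφ0 : ∀ p, φ 0 p = p) {A : E →L[ℝ] E}
    (hφA : ∀ θ p, HasDerivAt (fun θ => φ θ p) (A (φ θ p)) θ)
    {u : E → ℝ} (hu : ContDiffOn ℝ 1 u U) :
    ∫ p, fderiv ℝ u p (A p) ∂μ = 0 := by
  have hcont : ContinuousOn (fun p => fderiv ℝ u p (A p)) K :=
    ((hu.continuousOn_fderiv_of_isOpen hU le_rfl).mono hKU).clm_apply A.continuous.continuousOn
  obtain ⟨C, hC⟩ := hK.exists_bound_of_continuousOn hcont
  have huK : ContinuousOn u K := hu.continuousOn.mono hKU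
  obtain ⟨C', hC'⟩ := hK.exists_bound_of_continuousOn huK
  have hμr : μ.restrict K = μ := Measure.restrict_eq_self_of_ae_mem hμK
  have hmeas : AEStronglyMeasurable u μ := by
    rw [← hμr]; exact huK.aestronglyMeasurable hK.measurableSet
  have hmeas' : AEStronglyMeasurable (fun p => fderiv ℝ u p (A p)) μ := by
    rw [← hμr]; exact hcont.aestronglyMeasurable hK.measurableSet
  have hint : Integrable u μ :=
    Integrable.of_bound hmeas C' (hμK.mono fun p hp => hC' p hp)
  have hmeasθ : ∀ θ, AEStronglyMeasurable (fun p => u (φ θ p)) μ := fun θ =>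
    hmeas.comp_measurePreserving (hφ θ)
  have key := hasDerivAt_integral_of_dominated_loc_of_deriv_le (μ := μ)
    (F := fun θ p => u (φ θ p)) (F' := fun θ p => fderiv ℝ u (φ θ p) (A (φ θ p)))
    (x₀ := (0 : ℝ)) (s := Set.univ) (bound := fun _ => C) univ_mem
    (Eventually.of_forall hmeasθ) (by simpa only [hφ0] using hint)
    (hmeas'.comp_measurePreserving (hφ 0))
    (hμK.mono fun p hp θ _ => hC _ (hφK θ hp)) (integrable_const C)
    (hμK.mono fun p hp θ _ => by
      have hd : DifferentiableAt ℝ u (φ θ p) :=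
        (hu.differentiableOn one_ne_zero).differentiableAt (hU.mem_nhds (hKU (hφK θ hp)))
      exact hd.hasFDerivAt.comp_hasDerivAt θ (hφA θ p))
  have hconst : (fun θ => ∫ p, u (φ θ p) ∂μ) = fun _ => ∫ p, u p ∂μ := by
    funext θ
    have := integral_map (hφ θ).aemeasurable (f := u) (by rw [(hφ θ).map_eq]; exact hmeas)
    rw [(hφ θ).map_eq] at this
    exact this.symm
  have h := key.2
  rw [hconst] at h
  have := h.unique (hasDerivAt_const _ _)
  simpa only [hφ0] using this

/-! ### Rotations in a plane -/

section PlaneRotation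

variable {E : Type*} [NormedAddCommGroup E] [InnerProductSpace ℝ E]

/-- The infinitesimal rotation `p ↦ ⟪a, p⟫ c - ⟪c, p⟫ a` in the plane of `a` and `c`. -/
noncomputable def rotationGenerator (a c : E) : E →L[ℝ] E :=
  (innerSL ℝ a).smulRight c - (innerSL ℝ c).smulRight a

theorem rotationGenerator_apply (a c p : E) :
    rotationGenerator a c p = inner ℝ a p • c - inner ℝ c p • a := by
  simp [rotationGenerator]

/-- The rotation by the angle `θ` in the plane of `a` and `c`. -/
noncomputable def planeRotation (a c : E) (θ : ℝ) (p : E) : E :=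
  p + (1 - Real.cos θ) • rotationGenerator a c (rotationGenerator a c p)
    + Real.sin θ • rotationGenerator a c p

theorem planeRotation_zero (a c p : E) : planeRotation a c 0 p = p := by
  simp [planeRotation]

/-- The generator is a quarter turn on the plane of `a` and `c` and vanishes on its orthogonal
complement. The relation A³ = -A makes Rodrigues' formula 1 + (1 - cos θ) A² + sin θ A the flow of
A. -/
theorem rotationGenerator_cube {a c : E} (ha : ‖a‖ = 1) (hc : ‖c‖ = 1) (hac : inner ℝ a c = 0)
    (p : E) : rotationGenerator a c (rotationGenerator a c (rotationGenerator a c p))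
      = - rotationGenerator a c p := by
  have hca : inner ℝ c a = 0 := by rw [real_inner_comm, hac]
  simp only [rotationGenerator_apply, inner_sub_right, inner_smul_right, hac, hca,
    real_inner_self_eq_norm_sq, ha, hc]
  simp only [mul_zero, one_pow, mul_one, zero_sub, sub_zero]
  module

theorem inner_rotationGenerator_self (a c p : E) : inner ℝ (rotationGenerator a c p) p = 0 := by
  simp only [rotationGenerator_apply, inner_sub_left, real_inner_smul_left]
  ring

theorem inner_rotationGenerator_left (a c p q : E) :
    inner ℝ (rotationGenerator a c p) q = - inner ℝ p (rotationGenerator a c q) := by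
  simp only [rotationGenerator_apply, inner_sub_left, inner_sub_right, real_inner_smul_left,
    real_inner_smul_right, real_inner_comm p]
  ring

theorem hasDerivAt_planeRotation {a c : E} (ha : ‖a‖ = 1) (hc : ‖c‖ = 1) (hac : inner ℝ a c = 0)
    (p : E) (θ : ℝ) : HasDerivAt (fun θ => planeRotation a c θ p)
      (rotationGenerator a c (planeRotation a c θ p)) θ := by
  have h := (((hasDerivAt_const θ p).add (((hasDerivAt_const θ (1 : ℝ)).sub
    (Real.hasDerivAt_cos θ)).smul_const (rotationGenerator a c (rotationGenerator a c p)))).add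
    ((Real.hasDerivAt_sin θ).smul_const (rotationGenerator a c p)))
  refine h.congr_deriv ?_
  simp only [planeRotation, map_add, map_smul, rotationGenerator_cube ha hc hac]
  module

theorem norm_planeRotation {a c : E} (ha : ‖a‖ = 1) (hc : ‖c‖ = 1) (hac : inner ℝ a c = 0)
    (θ : ℝ) (p : E) : ‖planeRotation a c θ p‖ = ‖p‖ := by
  rw [← sq_eq_sq₀ (norm_nonneg _) (norm_nonneg _), ← real_inner_self_eq_norm_sq,
    ← real_inner_self_eq_norm_sq]
  -- By skewness and A³ = -A, all inner products among p, Ap and A²p reduce to |p|² and |Ap|²; the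
  -- coefficient of |Ap|² is then cos² + sin² - 1.
  have h1 := inner_rotationGenerator_self a c p
  have h2 := inner_rotationGenerator_self a c (rotationGenerator a c p)
  have h3 := inner_rotationGenerator_left a c (rotationGenerator a c p) p
  have h4 := inner_rotationGenerator_left a c (rotationGenerator a c p)
    (rotationGenerator a c (rotationGenerator a c p))
  rw [rotationGenerator_cube ha hc hac, inner_neg_right, neg_neg] at h4
  simp only [planeRotation, inner_add_left, inner_add_right, real_inner_smul_left,
    real_inner_smul_right, real_inner_comm p] at *
  rw [real_inner_comm (rotationGenerator a c (rotationGenerator a c p))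
    (rotationGenerator a c p)] at *
  rw [h1, h2, h3, h4]
  have := Real.sin_sq_add_cos_sq θ
  linear_combination (inner ℝ (rotationGenerator a c p) (rotationGenerator a c p)) * this

/-- `planeRotation` as a linear isometry. -/
noncomputable def planeRotationIsometry [FiniteDimensional ℝ E] {a c : E} (ha : ‖a‖ = 1)
    (hc : ‖c‖ = 1) (hac : inner ℝ a c = 0) (θ : ℝ) : E ≃ₗᵢ[ℝ] E :=
  LinearIsometry.toLinearIsometryEquiv (R₁ := ℝ)
    { toFun := planeRotation a c θ
      map_add' := fun p q => by simp only [planeRotation, map_add]; module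
      map_smul' := fun k p => by simp only [planeRotation, map_smul, RingHom.id_apply]; module
      norm_map' := norm_planeRotation ha hc hac θ } rfl

theorem coe_planeRotationIsometry [FiniteDimensional ℝ E] {a c : E} (ha : ‖a‖ = 1)
    (hc : ‖c‖ = 1) (hac : inner ℝ a c = 0) (θ : ℝ) :
    ⇑(planeRotationIsometry ha hc hac θ) = planeRotation a c θ := rfl

end PlaneRotation

/-! ### A spectral lower bound from finitely many eigenvectors -/

/-- Cauchy–Schwarz. The L² form is only semidefinite, since functions on the ambient space may
vanish almost everywhere on the spheres. -/
theorem apply_eq_zero_of_apply_self_eq_zero {V : Type*} [AddCommGroup V] [Module ℝ V]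
    {I : LinearMap.BilinForm ℝ V} (hI : ∀ v w, I v w = I w v) (hI0 : ∀ v, 0 ≤ I v v) {w : V}
    (hw : I w w = 0) (v : V) : I v w = 0 := by
  have h := LinearMap.BilinForm.apply_sq_le_of_symm I hI0 ⟨fun v w => hI v w⟩ v w
  rw [hw, mul_zero] at h
  exact pow_eq_zero_iff two_ne_zero |>.1 (le_antisymm h (sq_nonneg _))

/-- If `D u u` is a Dirichlet form, `I` an inner product, and `e k` are orthogonal eigenvectors
with eigenvalues at least `l`, or orthogonal to `u`, then the Poincaré inequality holds for `u` up
to the error of approximating `u` by `∑ e k`. -/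
theorem poincare_of_eigenvectors {V ι : Type*} [AddCommGroup V] [Module ℝ V]
    {I D : LinearMap.BilinForm ℝ V} (hI : ∀ v w, I v w = I w v) (hI0 : ∀ v, 0 ≤ I v v)
    (hD : ∀ v w, D v w = D w v) (hD0 : ∀ v, 0 ≤ D v v) (s : Finset ι) (e : ι → V) (c : ι → ℝ)
    (horth : ∀ j ∈ s, ∀ k ∈ s, j ≠ k → I (e j) (e k) = 0)
    (heig : ∀ k ∈ s, ∀ v, D v (e k) = c k * I v (e k)) {l : ℝ} (hl : 0 ≤ l) (u : V)
    (hc : ∀ k ∈ s, l ≤ c k ∨ I u (e k) = 0) :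
    l * (I u u - I (u - ∑ k ∈ s, e k) (u - ∑ k ∈ s, e k)) ≤ D u u := by
  -- Fourier coefficients of `u` and their energies. For a null vector `e k` division by zero gives
  -- 0, which is the right value.
  set a : ι → ℝ := fun k => I u (e k) / I (e k) (e k) with ha
  set β : ι → ℝ := fun k => (I u (e k)) ^ 2 / I (e k) (e k) with hβ
  have hβ0 : ∀ k, 0 ≤ β k := fun k => div_nonneg (sq_nonneg _) (hI0 _)
  have haβ : ∀ k, a k * I u (e k) = β k := fun k => by simp only [ha, hβ]; ring
  have haβ' : ∀ k, a k * (a k * I (e k) (e k)) = β k := fun k => by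
    by_cases h : I (e k) (e k) = 0
    · simp [ha, hβ, h]
    · simp only [ha, hβ]; field_simp
  set g : V := ∑ k ∈ s, a k • e k with hg
  have hsum : ∀ (b : ι → ℝ), ∀ k ∈ s, I (∑ j ∈ s, b j • e j) (e k) = b k * I (e k) (e k) := by
    intro b k hk
    rw [map_sum, LinearMap.sum_apply, Finset.sum_eq_single k]
    · simp
    · intro j hj hjk
      simp [horth j hj k hk hjk]
    · exact fun h => absurd hk h
  have hDug : D u g = ∑ k ∈ s, c k * β k := by
    rw [hg, map_sum]
    refine Finset.sum_congr rfl fun k hk => ?_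
    rw [map_smul, smul_eq_mul, heig k hk, ← haβ]; ring
  have hDgg : D g g = ∑ k ∈ s, c k * β k := by
    conv_lhs => rw [hg, map_sum]
    refine Finset.sum_congr rfl fun k hk => ?_
    rw [map_smul, smul_eq_mul, ← hg, heig k hk, hg, hsum a k hk, ← haβ']; ring
  -- Bessel's inequality for the Dirichlet form: `g` is the projection of `u` to the span of the `e
  -- k`, and D(u - g, u - g) is nonnegative.
  have h1 : ∑ k ∈ s, c k * β k ≤ D u u := by
    have := hD0 (u - g)
    simp only [map_sub, LinearMap.sub_apply, hD g u, hDug, hDgg] at this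
    linarith
  have h2 : l * ∑ k ∈ s, β k ≤ ∑ k ∈ s, c k * β k := by
    rw [Finset.mul_sum]
    refine Finset.sum_le_sum fun k hk => ?_
    rcases hc k hk with h | h
    · exact mul_le_mul_of_nonneg_right h (hβ0 k)
    · simp [hβ, h]
  refine le_trans (mul_le_mul_of_nonneg_left ?_ hl) (h2.trans h1)
  have hf : I u (∑ k ∈ s, e k) = ∑ k ∈ s, I u (e k) := map_sum _ _ _
  have hff : I (∑ k ∈ s, e k) (∑ k ∈ s, e k) = ∑ k ∈ s, I (e k) (e k) := by
    conv_lhs => rw [map_sum]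
    refine Finset.sum_congr rfl fun k hk => ?_
    simpa using hsum (fun _ => 1) k hk
  simp only [map_sub, LinearMap.sub_apply, hI _ u, hff, hf]
  -- Termwise 2x - y ≤ x²/y. In sum, the projection of `u` approximates it at least as well as `∑ e
  -- k` does.
  have : ∑ k ∈ s, (2 * I u (e k) - I (e k) (e k)) ≤ ∑ k ∈ s, β k := by
    refine Finset.sum_le_sum fun k _ => ?_
    rcases (hI0 (e k)).eq_or_lt with h | h
    · simp [hβ, apply_eq_zero_of_apply_self_eq_zero hI hI0 h.symm u, ← h]
    · simp only [hβ]
      rw [le_div_iff₀ h]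
      nlinarith [sq_nonneg (I u (e k) - I (e k) (e k))]
  rw [Finset.sum_sub_distrib, ← Finset.mul_sum] at this
  linarith

/-! ### Decomposing polynomials into eigenfunctions of the product Laplacian -/

namespace MvPolynomial

variable {σ : Type*}

/-- The derivation `X s ∂_t - X t ∂_s` of the polynomial ring. -/
noncomputable def rotationDerivation (s t : σ) :
    Derivation ℝ (MvPolynomial σ ℝ) (MvPolynomial σ ℝ) :=
  (X s : MvPolynomial σ ℝ) • pderiv t - (X t : MvPolynomial σ ℝ) • pderiv s

theorem rotationDerivation_apply (s t : σ) (P : MvPolynomial σ ℝ) :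
    rotationDerivation s t P = X s * pderiv t P - X t * pderiv s P := rfl

/-- The commutator of two derivations is a derivation, and this one kills the variables. -/
theorem pderiv_pderiv_comm (s t : σ) (P : MvPolynomial σ ℝ) :
    pderiv s (pderiv t P) = pderiv t (pderiv s P) := by
  classical
  have : ⁅pderiv (R := ℝ) s, pderiv (R := ℝ) t⁆ = 0 := by
    refine MvPolynomial.derivation_ext fun i => ?_
    rw [Derivation.commutator_apply, pderiv_X, pderiv_X]
    simp [Pi.single_apply, apply_ite]
  have h := congrArg (fun D => D P) this
  simpa [Derivation.commutator_apply, sub_eq_zero] using h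

variable {ι : Type*} [Fintype ι]

/-- The classical identity ∑ (x_i ∂_j - x_j ∂_i)² = 2 (|x|² Δ - E (E + d - 2)), where E is the Euler
operator and d the number of variables; the 2 comes from counting each plane twice. The hypothesis
`hP` says that E acts as `a`. -/
theorem sum_rotationDerivation_sq {f : ι → σ} (hf : Function.Injective f)
    {P : MvPolynomial σ ℝ} {a : ℝ} (hP : ∑ i, X (f i) * pderiv (f i) P = C a * P) :
    ∑ i, ∑ j, rotationDerivation (f i) (f j) (rotationDerivation (f i) (f j) P)
      = 2 * (∑ i, X (f i) ^ 2) * (∑ i, pderiv (f i) (pderiv (f i) P))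
        - C (2 * (a * (a + Fintype.card ι - 2))) * P := by
  classical
  have hX : ∀ i j, pderiv (f i) (X (f j) : MvPolynomial σ ℝ) = if i = j then 1 else 0 := by
    intro i j
    rw [pderiv_X, Pi.single_apply]
    exact if_congr (by rw [hf.eq_iff, eq_comm]) rfl rfl
  -- Applying the Euler operator twice gives a² P; removing the first-order part a P leaves the
  -- second-order part.
  have hM : ∑ i, ∑ j, X (f i) * X (f j) * pderiv (f i) (pderiv (f j) P) = C (a * a - a) * P := by
    have h2 : ∑ i, X (f i) * pderiv (f i) (C a * P) = C (a * a) * P := by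
      simp only [Derivation.leibniz, smul_eq_mul, pderiv_C, mul_zero, add_zero]
      simp only [mul_left_comm (X _) (C a), ← Finset.mul_sum, hP, C_mul, mul_assoc]
    rw [← hP] at h2
    simp only [map_sum, Derivation.leibniz, hX, smul_eq_mul, Finset.mul_sum, mul_add,
      Finset.sum_add_distrib, mul_ite, mul_one, mul_zero, Finset.sum_ite_eq, Finset.mem_univ,
      if_true] at h2
    rw [hP] at h2
    rw [C_sub, sub_mul, ← h2, add_sub_cancel_right]
    exact Finset.sum_congr rfl fun i _ => Finset.sum_congr rfl fun j _ => by ring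
  have hterm : ∀ i j, rotationDerivation (f i) (f j) (rotationDerivation (f i) (f j) P)
      = X (f i) ^ 2 * pderiv (f j) (pderiv (f j) P) + X (f j) ^ 2 * pderiv (f i) (pderiv (f i) P)
        - 2 * (X (f i) * X (f j) * pderiv (f i) (pderiv (f j) P))
        - X (f i) * pderiv (f i) P - X (f j) * pderiv (f j) P
        + if i = j then 2 * (X (f i) * pderiv (f i) P) else 0 := by
    intro i j
    simp only [rotationDerivation_apply, map_sub, Derivation.leibniz, hX, smul_eq_mul,
      pderiv_pderiv_comm (f j) (f i), if_true]
    by_cases hij : i = j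
    · subst hij; simp only [if_true]; ring
    · simp only [hij, Ne.symm hij, if_false]; ring
  simp only [hterm, Finset.sum_add_distrib, Finset.sum_sub_distrib, ← Finset.mul_sum,
    ← Finset.sum_mul, hM, Finset.sum_const, Finset.sum_ite_eq, Finset.mem_univ, if_true,
    Finset.card_univ, nsmul_eq_mul]
  simp only [mul_left_comm _ (Fintype.card ι : MvPolynomial σ ℝ), ← Finset.mul_sum, hP]
  simp only [map_mul, map_sub, map_add, map_ofNat, map_natCast]
  ring

theorem sum_X_mul_pderiv_monomial (f : ι → σ) (α : σ →₀ ℕ) (c : ℝ) :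
    ∑ i, X (f i) * pderiv (f i) (monomial α c) = C ((∑ i, α (f i) : ℕ) : ℝ) * monomial α c := by
  classical
  simp only [X_mul_pderiv_monomial, nsmul_eq_mul, map_sum, map_natCast, Nat.cast_sum, Finset.sum_mul]


variable {κ : Type*} [Fintype κ]

/-- The Laplacian of the product of the sphere of radius `r` in the first block of variables and of
the unit sphere in the second one, with the sign for which it is nonnegative. -/
noncomputable def productLaplacian (r : ℝ) :
    MvPolynomial (ι ⊕ κ) ℝ →ₗ[ℝ] MvPolynomial (ι ⊕ κ) ℝ :=
  - ((1 / (2 * r ^ 2)) • (∑ i : ι, ∑ j : ι,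
        ((rotationDerivation (Sum.inl i) (Sum.inl j) : Derivation ℝ (MvPolynomial (ι ⊕ κ) ℝ) _) :
          MvPolynomial (ι ⊕ κ) ℝ →ₗ[ℝ] _) ∘ₗ
        ((rotationDerivation (Sum.inl i) (Sum.inl j) : Derivation ℝ (MvPolynomial (ι ⊕ κ) ℝ) _) :
          MvPolynomial (ι ⊕ κ) ℝ →ₗ[ℝ] _))
      + (1 / 2 : ℝ) • (∑ i : κ, ∑ j : κ,
        ((rotationDerivation (Sum.inr i) (Sum.inr j) : Derivation ℝ (MvPolynomial (ι ⊕ κ) ℝ) _) :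
          MvPolynomial (ι ⊕ κ) ℝ →ₗ[ℝ] _) ∘ₗ
        ((rotationDerivation (Sum.inr i) (Sum.inr j) : Derivation ℝ (MvPolynomial (ι ⊕ κ) ℝ) _) :
          MvPolynomial (ι ⊕ κ) ℝ →ₗ[ℝ] _)))

theorem productLaplacian_apply (r : ℝ) (P : MvPolynomial (ι ⊕ κ) ℝ) :
    productLaplacian r P = - ((1 / (2 * r ^ 2)) • (∑ i : ι, ∑ j : ι,
        rotationDerivation (Sum.inl i) (Sum.inl j)
          (rotationDerivation (Sum.inl i) (Sum.inl j) P))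
      + (1 / 2 : ℝ) • (∑ i : κ, ∑ j : κ,
        rotationDerivation (Sum.inr i) (Sum.inr j)
          (rotationDerivation (Sum.inr i) (Sum.inr j) P))) := by
  simp [productLaplacian, LinearMap.sum_apply]

/-- The sum of the Laplacians of the two blocks of variables. -/
noncomputable def flatLaplacian (P : MvPolynomial (ι ⊕ κ) ℝ) : MvPolynomial (ι ⊕ κ) ℝ :=
  ∑ i : ι, pderiv (Sum.inl i) (pderiv (Sum.inl i) P)
    + ∑ j : κ, pderiv (Sum.inr j) (pderiv (Sum.inr j) P)

variable (ι κ) in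
/-- The points with coordinates in the product of two spheres. -/
def spherePoints (r : ℝ) : Set (ι ⊕ κ → ℝ) :=
  {x | ∑ i, x (Sum.inl i) ^ 2 = r ^ 2 ∧ ∑ j, x (Sum.inr j) ^ 2 = 1}

variable (ι κ) in
/-- The eigenvalue of `productLaplacian` that belongs to the bidegree `(a, b)`. -/
noncomputable def bidegreeEigenvalue (r : ℝ) (a b : ℕ) : ℝ :=
  a * (a + Fintype.card ι - 2) / r ^ 2 + b * (b + Fintype.card κ - 2)

/-- The degree in the first block of variables. -/
def degreeLeft (α : ι ⊕ κ →₀ ℕ) : ℕ := ∑ i, α (Sum.inl i)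

/-- The degree in the second block of variables. -/
def degreeRight (α : ι ⊕ κ →₀ ℕ) : ℕ := ∑ j, α (Sum.inr j)

theorem eval_productLaplacian_monomial {r : ℝ} (hr : r ≠ 0) (α : ι ⊕ κ →₀ ℕ) (k : ℝ)
    {x : ι ⊕ κ → ℝ} (hx : x ∈ spherePoints ι κ r) :
    eval x (productLaplacian r (monomial α k))
      = bidegreeEigenvalue ι κ r (degreeLeft α) (degreeRight α) * eval x (monomial α k)
        - eval x (flatLaplacian (monomial α k)) := by
  obtain ⟨h1, h2⟩ := hx
  rw [productLaplacian_apply,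
    sum_rotationDerivation_sq Sum.inl_injective (sum_X_mul_pderiv_monomial Sum.inl α k),
    sum_rotationDerivation_sq Sum.inr_injective (sum_X_mul_pderiv_monomial Sum.inr α k)]
  simp only [map_neg, map_add, smul_eval, map_sub, map_mul, map_sum, map_pow, eval_X, h1, h2,
    map_ofNat, map_natCast, flatLaplacian, bidegreeEigenvalue, degreeLeft,
    degreeRight]
  field_simp
  ring

/-- The polynomials that restrict to eigenfunctions for the eigenvalue `c` on the product of the
spheres and, if `c < l`, to constants. -/
noncomputable def eigenpolynomials (r l c : ℝ) : Submodule ℝ (MvPolynomial (ι ⊕ κ) ℝ) where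
  carrier := {P | (∀ x ∈ spherePoints ι κ r, eval x (productLaplacian r P) = c * eval x P) ∧
    (c < l → ∃ k : ℝ, ∀ x ∈ spherePoints ι κ r, eval x P = k)}
  zero_mem' := ⟨by simp, fun _ => ⟨0, by simp⟩⟩
  add_mem' := by
    rintro P Q ⟨hP, hP'⟩ ⟨hQ, hQ'⟩
    refine ⟨fun x hx => by rw [map_add, map_add, map_add, hP x hx, hQ x hx, mul_add],
      fun hc => ?_⟩
    obtain ⟨k, hk⟩ := hP' hc
    obtain ⟨k', hk'⟩ := hQ' hc
    exact ⟨k + k', fun x hx => by rw [map_add, hk x hx, hk' x hx]⟩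
  smul_mem' := by
    rintro a P ⟨hP, hP'⟩
    refine ⟨fun x hx => by rw [map_smul, smul_eval, smul_eval, hP x hx]; ring, fun hc => ?_⟩
    obtain ⟨k, hk⟩ := hP' hc
    exact ⟨a * k, fun x hx => by rw [smul_eval, hk x hx]⟩

/-- The function t (t + k - 2) is strictly increasing on the natural numbers when k ≥ 2. For k = 1
it takes the value 0 at both t = 0 and t = 1. -/
theorem bidegreeEigenvalue_lt (hι : 2 ≤ Fintype.card ι) (hκ : 2 ≤ Fintype.card κ) {r : ℝ}
    (hr : r ≠ 0) {a b a' b' : ℕ} (ha : a' ≤ a) (hb : b' ≤ b) (h : a' < a ∨ b' < b) :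
    bidegreeEigenvalue ι κ r a' b' < bidegreeEigenvalue ι κ r a b := by
  have hι' : (2 : ℝ) ≤ Fintype.card ι := by exact_mod_cast hι
  have hκ' : (2 : ℝ) ≤ Fintype.card κ := by exact_mod_cast hκ
  have hle : ∀ {x y : ℕ} {k : ℝ}, 2 ≤ k → x ≤ y →
      (x : ℝ) * (x + k - 2) ≤ y * (y + k - 2) := by
    intro x y k hk hxy
    have : (x : ℝ) ≤ y := by exact_mod_cast hxy
    have hx : (0 : ℝ) ≤ x := x.cast_nonneg
    exact mul_le_mul this (by linarith) (by linarith) (by linarith)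
  have hlt : ∀ {x y : ℕ} {k : ℝ}, 2 ≤ k → x < y →
      (x : ℝ) * (x + k - 2) < y * (y + k - 2) := by
    intro x y k hk hxy
    have : (x : ℝ) < y := by exact_mod_cast hxy
    have hx : (0 : ℝ) ≤ x := x.cast_nonneg
    nlinarith
  have hr2 : 0 < r ^ 2 := by positivity
  unfold bidegreeEigenvalue
  rcases h with h | h
  · exact add_lt_add_of_lt_of_le (div_lt_div_of_pos_right (hlt hι' h) hr2) (hle hκ' hb)
  · exact add_lt_add_of_le_of_lt (div_le_div_of_nonneg_right (hle hι' ha) hr2.le) (hlt hκ' h)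

/-- By monotonicity the least eigenvalue away from (0, 0) occurs at (1, 0) or (0, 1); the two bounds
on `l` are these values. -/
theorem le_bidegreeEigenvalue (hι : 2 ≤ Fintype.card ι) (hκ : 2 ≤ Fintype.card κ) {r l : ℝ}
    (hr : r ≠ 0) (hl1 : l ≤ (Fintype.card ι - 1) / r ^ 2) (hl2 : l ≤ Fintype.card κ - 1)
    {a b : ℕ} (h : ¬ (a = 0 ∧ b = 0)) : l ≤ bidegreeEigenvalue ι κ r a b := by
  have hmono : ∀ {a b a' b' : ℕ}, a' ≤ a → b' ≤ b →
      bidegreeEigenvalue ι κ r a' b' ≤ bidegreeEigenvalue ι κ r a b := by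
    intro a b a' b' ha hb
    by_cases h : a' < a ∨ b' < b
    · exact (bidegreeEigenvalue_lt hι hκ hr ha hb h).le
    · push Not at h
      rw [le_antisymm ha h.1, le_antisymm hb h.2]
  rcases Nat.eq_zero_or_pos a with ha | ha
  · refine le_trans ?_ (hmono (Nat.zero_le a) (Nat.one_le_iff_ne_zero.2 fun hb => h ⟨ha, hb⟩))
    simp only [bidegreeEigenvalue, Nat.cast_zero, zero_mul, zero_div, Nat.cast_one]
    linarith
  · refine le_trans (hl1.trans (le_of_eq ?_)) (hmono ha (Nat.zero_le b))
    simp only [bidegreeEigenvalue, Nat.cast_zero, zero_mul, Nat.cast_one]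
    ring

/-- On eigenfunctions with eigenvalue c' < c, the Laplacian minus c is multiplication by c' - c ≠ 0,
hence invertible on the span of all of them. -/
theorem exists_sub_productLaplacian_eq {r l c : ℝ} {R : MvPolynomial (ι ⊕ κ) ℝ}
    (hR : R ∈ ⨆ c' : Set.Iio c, eigenpolynomials (ι := ι) (κ := κ) r l c') :
    ∃ T ∈ ⨆ c' : Set.Iio c, eigenpolynomials (ι := ι) (κ := κ) r l c',
      ∀ x ∈ spherePoints ι κ r,
        eval x (productLaplacian r T) - c * eval x T = eval x R := by
  refine Submodule.iSup_induction _ (motive := fun R => ∃ T ∈ ⨆ c' : Set.Iio c,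
    eigenpolynomials (ι := ι) (κ := κ) r l c', ∀ x ∈ spherePoints ι κ r,
      eval x (productLaplacian r T) - c * eval x T = eval x R) hR ?_ ?_ ?_
  · intro c' P hP
    refine ⟨((c' : ℝ) - c)⁻¹ • P, Submodule.smul_mem _ _ (Submodule.mem_iSup_of_mem c' hP), ?_⟩
    intro x hx
    have : (c' : ℝ) - c ≠ 0 := (sub_neg.2 c'.2).ne
    rw [map_smul, smul_eval, smul_eval, hP.1 x hx]
    field_simp
  · exact ⟨0, Submodule.zero_mem _, by simp⟩
  · rintro P Q ⟨T, hT, hT'⟩ ⟨T', hT2, hT2'⟩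
    refine ⟨T + T', Submodule.add_mem _ hT hT2, fun x hx => ?_⟩
    simp only [map_add, ← hT' x hx, ← hT2' x hx]
    ring

theorem iSup_subtype_mono {ι' α : Type*} [CompleteLattice α] (f : ι' → α) {s t : Set ι'}
    (h : s ⊆ t) : ⨆ c : s, f c ≤ ⨆ c : t, f c :=
  iSup_le fun c => le_iSup_of_le (⟨c, h c.2⟩ : t) le_rfl

theorem iSup_subtype_le {ι' α : Type*} [CompleteLattice α] (f : ι' → α) (s : Set ι') :
    ⨆ c : s, f c ≤ ⨆ c, f c :=
  iSup_le fun c => le_iSup f c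

/-- If the exponent of `s` is less than 2, the coefficient of the second derivative is zero, so
truncated subtraction does no harm. -/
theorem pderiv_pderiv_monomial_mem {σ : Type*} {p : Submodule ℝ (MvPolynomial σ ℝ)}
    {α : σ →₀ ℕ} {s : σ} (h : 2 ≤ α s → monomial (α - Finsupp.single s 2) (1 : ℝ) ∈ p) :
    pderiv s (pderiv s (monomial α (1 : ℝ))) ∈ p := by
  rw [pderiv_monomial, pderiv_monomial, tsub_tsub, ← Finsupp.single_add]
  by_cases hs : 2 ≤ α s
  · rw [← mul_one (_ * _ : ℝ), ← smul_eq_mul (_ * _ : ℝ) 1, ← smul_monomial]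
    exact p.smul_mem _ (h hs)
  · convert p.zero_mem
    rw [monomial_eq_zero]
    have : α s = 0 ∨ α s = 1 := by omega
    rcases this with h | h <;> simp [h]

/-- Induction on the degree. The flat Laplacian of the monomial lies in the span for smaller
eigenvalues, so a correction `T` from this span turns the monomial into an eigenfunction for its own
eigenvalue `c`. -/
theorem monomial_mem_iSup_eigenpolynomials (hι : 2 ≤ Fintype.card ι) (hκ : 2 ≤ Fintype.card κ)
    {r l : ℝ} (hr : r ≠ 0) (hl1 : l ≤ (Fintype.card ι - 1) / r ^ 2)
    (hl2 : l ≤ Fintype.card κ - 1) (α : ι ⊕ κ →₀ ℕ) :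
    monomial α (1 : ℝ) ∈
      ⨆ c : Set.Iic (bidegreeEigenvalue ι κ r (degreeLeft α) (degreeRight α)),
        eigenpolynomials (ι := ι) (κ := κ) r l c := by
  classical
  induction hd : α.degree using Nat.strong_induction_on generalizing α with
  | _ d ih =>
  set c := bidegreeEigenvalue ι κ r (degreeLeft α) (degreeRight α) with hc
  have hstep : ∀ s : ι ⊕ κ, 2 ≤ α s → monomial (α - Finsupp.single s 2) (1 : ℝ) ∈
      ⨆ c' : Set.Iio c, eigenpolynomials (ι := ι) (κ := κ) r l c' := by
    intro s hs
    have hle : Finsupp.single s 2 ≤ α := by simpa using hs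
    have hadd : α - Finsupp.single s 2 + Finsupp.single s 2 = α := tsub_add_cancel_of_le hle
    have hdeg : (α - Finsupp.single s 2).degree + 2 = d := by
      rw [← hd]; conv_rhs => rw [← hadd]
      simp
    have hL : degreeLeft (α - Finsupp.single s 2) + degreeLeft (Finsupp.single s 2)
        = degreeLeft α := by
      conv_rhs => rw [← hadd]
      simp only [degreeLeft, Finsupp.add_apply, Finset.sum_add_distrib]
    have hR : degreeRight (α - Finsupp.single s 2) + degreeRight (Finsupp.single s 2)
        = degreeRight α := by
      conv_rhs => rw [← hadd]
      simp only [degreeRight, Finsupp.add_apply, Finset.sum_add_distrib]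
    have hpos : 0 < degreeLeft (Finsupp.single s 2) ∨ 0 < degreeRight (Finsupp.single s 2) := by
      rcases s with i | j
      · left; simp [degreeLeft, Finsupp.single_apply]
      · right; simp [degreeRight, Finsupp.single_apply]
    have hlt : bidegreeEigenvalue ι κ r (degreeLeft (α - Finsupp.single s 2))
        (degreeRight (α - Finsupp.single s 2)) < c :=
      bidegreeEigenvalue_lt hι hκ hr (by omega) (by omega) (by omega)
    exact iSup_subtype_mono (eigenpolynomials (ι := ι) (κ := κ) r l) (Set.Iic_subset_Iio.2 hlt)
      (ih (α - Finsupp.single s 2).degree (by omega) _ rfl)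
  have hflat : flatLaplacian (monomial α (1 : ℝ)) ∈
      ⨆ c' : Set.Iio c, eigenpolynomials (ι := ι) (κ := κ) r l c' :=
    Submodule.add_mem _
      (Submodule.sum_mem _ fun i _ => pderiv_pderiv_monomial_mem (hstep _))
      (Submodule.sum_mem _ fun i _ => pderiv_pderiv_monomial_mem (hstep _))
  obtain ⟨T, hT, hT'⟩ := exists_sub_productLaplacian_eq hflat
  have hTmem : T ∈ ⨆ c' : Set.Iic c, eigenpolynomials (ι := ι) (κ := κ) r l c' :=
    iSup_subtype_mono (eigenpolynomials (ι := ι) (κ := κ) r l) Set.Iio_subset_Iic_self hT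
  -- Only the constant monomial can have an eigenvalue below `l`; for every other bidegree the
  -- second condition on eigenpolynomials is vacuous.
  by_cases h0 : degreeLeft α = 0 ∧ degreeRight α = 0
  · have hα : α = 0 := by
      ext s
      rcases s with i | j
      · exact Finset.sum_eq_zero_iff.1 h0.1 i (Finset.mem_univ i)
      · exact Finset.sum_eq_zero_iff.1 h0.2 j (Finset.mem_univ j)
    refine Submodule.mem_iSup_of_mem (⟨c, Set.mem_Iic.2 le_rfl⟩ : Set.Iic c) ⟨fun x hx => ?_, ?_⟩
    · have : flatLaplacian (monomial α (1 : ℝ)) = 0 := by simp [flatLaplacian, hα]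
      rw [eval_productLaplacian_monomial hr α 1 hx, this, map_zero, sub_zero]
    · exact fun _ => ⟨1, fun x _ => by simp [hα]⟩
  · have hmem : monomial α (1 : ℝ) + T ∈ eigenpolynomials (ι := ι) (κ := κ) r l c := by
      refine ⟨fun x hx => ?_, fun hcl =>
        absurd hcl (le_bidegreeEigenvalue hι hκ hr hl1 hl2 h0).not_gt⟩
      rw [map_add, map_add, map_add, eval_productLaplacian_monomial hr α 1 hx, ← hT' x hx]
      ring
    rw [← add_sub_cancel_right (monomial α (1 : ℝ)) T]
    exact Submodule.sub_mem _
      (Submodule.mem_iSup_of_mem (⟨c, Set.mem_Iic.2 le_rfl⟩ : Set.Iic c) hmem) hTmem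

theorem exists_eq_sum_eigenpolynomials (hι : 2 ≤ Fintype.card ι) (hκ : 2 ≤ Fintype.card κ)
    {r l : ℝ} (hr : r ≠ 0) (hl1 : l ≤ (Fintype.card ι - 1) / r ^ 2)
    (hl2 : l ≤ Fintype.card κ - 1) (P : MvPolynomial (ι ⊕ κ) ℝ) :
    ∃ (s : Finset ℝ) (e : ℝ → MvPolynomial (ι ⊕ κ) ℝ),
      (∀ c, e c ∈ eigenpolynomials (ι := ι) (κ := κ) r l c) ∧ ∑ c ∈ s, e c = P := by
  have hP : P ∈ ⨆ c : ℝ, eigenpolynomials (ι := ι) (κ := κ) r l c := by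
    rw [P.as_sum]
    refine Submodule.sum_mem _ fun α _ => ?_
    rw [← mul_one (coeff α P), ← smul_eq_mul, ← smul_monomial]
    refine Submodule.smul_mem _ _ ?_
    exact iSup_subtype_le (eigenpolynomials (ι := ι) (κ := κ) r l) _
      (monomial_mem_iSup_eigenpolynomials hι hκ hr hl1 hl2 α)
  obtain ⟨f, hf, rfl⟩ := (Submodule.mem_iSup_iff_exists_finsupp _ _).1 hP
  exact ⟨f.support, f, hf, rfl⟩

end MvPolynomial

/-! ### Integration by parts on a product of spheres -/

section ProductOfSpheres

open MvPolynomial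

variable {E : Type*} [NormedAddCommGroup E] [InnerProductSpace ℝ E]
  {ι κ : Type*} [Fintype ι] [Fintype κ]

/-- The polynomial function on `E` in the coordinates of an orthonormal basis. -/
noncomputable def polynomialFunction {σ : Type*} [Fintype σ] (b : OrthonormalBasis σ ℝ E)
    (P : MvPolynomial σ ℝ) (p : E) : ℝ :=
  eval (fun s => inner ℝ (b s) p) P

theorem polynomialFunction_C {σ : Type*} [Fintype σ] (b : OrthonormalBasis σ ℝ E) (a : ℝ) :
    polynomialFunction b (C a) = fun _ => a := by
  funext p; simp [polynomialFunction]

theorem polynomialFunction_add {σ : Type*} [Fintype σ] (b : OrthonormalBasis σ ℝ E)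
    (P Q : MvPolynomial σ ℝ) :
    polynomialFunction b (P + Q) = polynomialFunction b P + polynomialFunction b Q := by
  funext p; simp [polynomialFunction]

theorem polynomialFunction_mul_X {σ : Type*} [Fintype σ] (b : OrthonormalBasis σ ℝ E)
    (P : MvPolynomial σ ℝ) (t : σ) :
    polynomialFunction b (P * X t) = fun p => polynomialFunction b P p * innerSL ℝ (b t) p := by
  funext p; simp [polynomialFunction]

theorem hasFDerivAt_polynomialFunction {σ : Type*} [Fintype σ] (b : OrthonormalBasis σ ℝ E)
    (P : MvPolynomial σ ℝ) (p : E) :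
    HasFDerivAt (polynomialFunction b P)
      (∑ s, polynomialFunction b (pderiv s P) p • innerSL ℝ (b s)) p := by
  classical
  induction P using MvPolynomial.induction_on with
  | C a =>
    rw [polynomialFunction_C]
    refine (hasFDerivAt_const a p).congr_fderiv ?_
    simp [polynomialFunction]
  | add P Q hP hQ =>
    rw [polynomialFunction_add]
    refine (hP.add hQ).congr_fderiv ?_
    simp only [map_add, polynomialFunction_add, Pi.add_apply, add_smul, Finset.sum_add_distrib]
  | mul_X P t hP =>
    rw [polynomialFunction_mul_X]
    refine (hP.mul (innerSL ℝ (b t)).hasFDerivAt).congr_fderiv ?_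
    simp only [polynomialFunction, Derivation.leibniz, smul_eq_mul, map_add, map_mul, eval_X,
      add_smul, Finset.sum_add_distrib, pderiv_X, Pi.single_apply, Finset.smul_sum, smul_smul,
      innerSL_apply_apply]
    congr 1
    rw [Finset.sum_eq_single t]
    · simp
    · intro s _ hs
      simp [Ne.symm hs]
    · simp

theorem contDiff_polynomialFunction {σ : Type*} [Fintype σ] (b : OrthonormalBasis σ ℝ E)
    (P : MvPolynomial σ ℝ) {k : WithTop ℕ∞} : ContDiff ℝ k (polynomialFunction b P) := by
  induction P using MvPolynomial.induction_on with
  | C a => rw [polynomialFunction_C]; exact contDiff_const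
  | add P Q hP hQ => rw [polynomialFunction_add]; exact hP.add hQ
  | mul_X P t hP => rw [polynomialFunction_mul_X]; exact hP.mul (innerSL ℝ (b t)).contDiff

/-- The derivative of `u` along the infinitesimal rotation in the plane of `b s` and `b t`. -/
noncomputable def rotationDeriv {σ : Type*} [Fintype σ] (b : OrthonormalBasis σ ℝ E) (s t : σ)
    (u : E → ℝ) (p : E) : ℝ :=
  fderiv ℝ u p (rotationGenerator (b s) (b t) p)

/-- The bridge between the geometric rotation fields and the algebraic derivations of the polynomial
ring. -/
theorem rotationDeriv_polynomialFunction {σ : Type*} [Fintype σ] (b : OrthonormalBasis σ ℝ E)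
    (s t : σ) (P : MvPolynomial σ ℝ) :
    rotationDeriv b s t (polynomialFunction b P)
      = polynomialFunction b (rotationDerivation s t P) := by
  classical
  funext p
  have hb : ∀ i j, inner ℝ (b i) (b j) = if i = j then (1 : ℝ) else 0 :=
    orthonormal_iff_ite.1 b.orthonormal
  rw [rotationDeriv, (hasFDerivAt_polynomialFunction b P p).fderiv]
  simp only [sum_apply, smul_apply, innerSL_apply_apply,
    rotationGenerator_apply, inner_sub_right, inner_smul_right, hb, smul_eq_mul, mul_sub,
    Finset.sum_sub_distrib, mul_ite, mul_one, mul_zero, Finset.sum_ite_eq', Finset.mem_univ,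
    if_true]
  simp only [polynomialFunction, rotationDerivation_apply, map_sub, map_mul, eval_X]
  ring

theorem rotationDeriv_mul {σ : Type*} [Fintype σ] (b : OrthonormalBasis σ ℝ E) (s t : σ)
    {u v : E → ℝ} {p : E} (hu : DifferentiableAt ℝ u p) (hv : DifferentiableAt ℝ v p) :
    rotationDeriv b s t (u * v) p = rotationDeriv b s t u p * v p + u p * rotationDeriv b s t v p := by
  rw [rotationDeriv, (hu.hasFDerivAt.mul hv.hasFDerivAt).fderiv]
  simp only [add_apply, smul_apply, smul_eq_mul,
    rotationDeriv]
  ring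

/-- The product of the sphere of radius `r` in the span of the first block of basis vectors and of
the unit sphere in the span of the second one. -/
def coordinateSpheres (b : OrthonormalBasis (ι ⊕ κ) ℝ E) (r : ℝ) : Set E :=
  {p | (fun s => inner ℝ (b s) p) ∈ spherePoints ι κ r}

/-- `μ` is concentrated on the product of spheres and invariant under its linear isometries. -/
structure IsInvariantOnSpheres [MeasurableSpace E] (b : OrthonormalBasis (ι ⊕ κ) ℝ E) (r : ℝ)
    (μ : Measure E) : Prop where
  ae_mem : ∀ᵐ p ∂μ, p ∈ coordinateSpheres b r
  invariant : ∀ e : E ≃ₗᵢ[ℝ] E, e ⁻¹' coordinateSpheres b r = coordinateSpheres b r →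
    MeasurePreserving e μ μ

theorem sum_inner_sq (b : OrthonormalBasis (ι ⊕ κ) ℝ E) (p : E) :
    ∑ i, inner ℝ (b (Sum.inl i)) p ^ 2 + ∑ j, inner ℝ (b (Sum.inr j)) p ^ 2 = ‖p‖ ^ 2 := by
  rw [← b.sum_sq_norm_inner_right p, Fintype.sum_sum_type]
  simp only [Real.norm_eq_abs, sq_abs]

theorem isCompact_coordinateSpheres [FiniteDimensional ℝ E] (b : OrthonormalBasis (ι ⊕ κ) ℝ E)
    (r : ℝ) : IsCompact (coordinateSpheres b r) := by
  refine Metric.isCompact_of_isClosed_isBounded ?_ ?_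
  · refine IsClosed.inter (isClosed_eq ?_ continuous_const) (isClosed_eq ?_ continuous_const) <;>
    fun_prop
  · refine (Metric.isBounded_iff_subset_closedBall 0).2 ⟨Real.sqrt (r ^ 2 + 1), fun p hp => ?_⟩
    rw [mem_closedBall_zero_iff]
    apply Real.le_sqrt_of_sq_le
    rw [← sum_inner_sq b p, hp.1, hp.2]

theorem inner_planeRotation_of_orthogonal {a c v : E} (ha : inner ℝ v a = 0)
    (hc : inner ℝ v c = 0) (θ : ℝ) (p : E) :
    inner ℝ v (planeRotation a c θ p) = inner ℝ v p := by
  simp [planeRotation, rotationGenerator_apply, inner_add_right, inner_sub_right,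
    inner_smul_right, ha, hc]

/-- A rotation within one block fixes the coordinates of the other block and preserves the total
norm, hence also the norm of its own block. -/
theorem planeRotation_mem_coordinateSpheres_iff (b : OrthonormalBasis (ι ⊕ κ) ℝ E) {r : ℝ}
    {s t : ι ⊕ κ} (hst : s ≠ t) (hblock : s.isLeft = t.isLeft) (θ : ℝ) (p : E) :
    planeRotation (b s) (b t) θ p ∈ coordinateSpheres b r ↔ p ∈ coordinateSpheres b r := by
  have hb : ∀ {i j}, i ≠ j → inner ℝ (b i) (b j) = 0 := fun h => b.orthonormal.2 h
  have hn := norm_planeRotation (b.norm_eq_one s) (b.norm_eq_one t) (hb hst) θ p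
  have h1 := sum_inner_sq b p
  have h2 := sum_inner_sq b (planeRotation (b s) (b t) θ p)
  rw [hn, ← h1] at h2
  have key : ∑ i, inner ℝ (b (Sum.inl i)) (planeRotation (b s) (b t) θ p) ^ 2
        = ∑ i, inner ℝ (b (Sum.inl i)) p ^ 2 ∧
      ∑ j, inner ℝ (b (Sum.inr j)) (planeRotation (b s) (b t) θ p) ^ 2
        = ∑ j, inner ℝ (b (Sum.inr j)) p ^ 2 := by
    rcases s with i | j <;> rcases t with i' | j' <;> simp at hblock
    · have : ∑ j, inner ℝ (b (Sum.inr j)) (planeRotation (b (.inl i)) (b (.inl i')) θ p) ^ 2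
        = ∑ j, inner ℝ (b (Sum.inr j)) p ^ 2 := Finset.sum_congr rfl fun j _ => by
          rw [inner_planeRotation_of_orthogonal (hb (by simp)) (hb (by simp))]
      exact ⟨by linarith, this⟩
    · have : ∑ i, inner ℝ (b (Sum.inl i)) (planeRotation (b (.inr j)) (b (.inr j')) θ p) ^ 2
        = ∑ i, inner ℝ (b (Sum.inl i)) p ^ 2 := Finset.sum_congr rfl fun j _ => by
          rw [inner_planeRotation_of_orthogonal (hb (by simp)) (hb (by simp))]
      exact ⟨this, by linarith⟩
  simp only [coordinateSpheres, spherePoints, Set.mem_ofPred_eq, key]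

theorem continuousOn_rotationDeriv (b : OrthonormalBasis (ι ⊕ κ) ℝ E) {U K : Set E}
    (hU : IsOpen U) (hKU : K ⊆ U) {u : E → ℝ} (hu : ContDiffOn ℝ 1 u U) (s t : ι ⊕ κ) :
    ContinuousOn (rotationDeriv b s t u) K :=
  ((hu.continuousOn_fderiv_of_isOpen hU le_rfl).mono hKU).clm_apply
    (rotationGenerator (b s) (b t)).continuous.continuousOn

/-- The inner product of the gradients of `u` and `v` on the product of spheres. -/
noncomputable def gradientProduct (b : OrthonormalBasis (ι ⊕ κ) ℝ E) (r : ℝ) (u v : E → ℝ)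
    (p : E) : ℝ :=
  1 / (2 * r ^ 2) * (∑ i : ι, ∑ j : ι, rotationDeriv b (Sum.inl i) (Sum.inl j) u p *
      rotationDeriv b (Sum.inl i) (Sum.inl j) v p)
    + 1 / 2 * ∑ i : κ, ∑ j : κ, rotationDeriv b (Sum.inr i) (Sum.inr j) u p *
      rotationDeriv b (Sum.inr i) (Sum.inr j) v p

theorem continuousOn_gradientProduct (b : OrthonormalBasis (ι ⊕ κ) ℝ E) (r : ℝ) {U K : Set E}
    (hU : IsOpen U) (hKU : K ⊆ U) {u v : E → ℝ} (hu : ContDiffOn ℝ 1 u U)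
    (hv : ContDiffOn ℝ 1 v U) : ContinuousOn (gradientProduct b r u v) K := by
  have hc : ∀ s t, ContinuousOn (fun p => rotationDeriv b s t u p * rotationDeriv b s t v p) K :=
    fun s t => (continuousOn_rotationDeriv b hU hKU hu s t).mul
      (continuousOn_rotationDeriv b hU hKU hv s t)
  exact (continuousOn_const.mul (continuousOn_finsetSum _ fun i _ =>
    continuousOn_finsetSum _ fun j _ => hc _ _)).add
    (continuousOn_const.mul (continuousOn_finsetSum _ fun i _ =>
    continuousOn_finsetSum _ fun j _ => hc _ _))

variable [FiniteDimensional ℝ E] [MeasurableSpace E] [BorelSpace E]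

theorem IsInvariantOnSpheres.integral_rotationDeriv {b : OrthonormalBasis (ι ⊕ κ) ℝ E} {r : ℝ}
    {μ : Measure E} [IsFiniteMeasure μ] (hμ : IsInvariantOnSpheres b r μ) {U : Set E}
    (hU : IsOpen U) (hKU : coordinateSpheres b r ⊆ U) {s t : ι ⊕ κ}
    (hblock : s.isLeft = t.isLeft) {u : E → ℝ} (hu : ContDiffOn ℝ 1 u U) :
    ∫ p, rotationDeriv b s t u p ∂μ = 0 := by
  by_cases hst : s = t
  · subst hst
    simp [rotationDeriv, rotationGenerator_apply]
  have hb : inner ℝ (b s) (b t) = 0 := b.orthonormal.2 hst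
  refine integral_fderiv_flow_eq_zero (isCompact_coordinateSpheres b r) hμ.ae_mem hU hKU
    (φ := planeRotation (b s) (b t)) (fun θ => ?_)
    (fun θ p hp => (planeRotation_mem_coordinateSpheres_iff b hst hblock θ p).2 hp)
    (planeRotation_zero _ _)
    (fun θ p => hasDerivAt_planeRotation (b.norm_eq_one s) (b.norm_eq_one t) hb p θ) hu
  have := hμ.invariant (planeRotationIsometry (b.norm_eq_one s) (b.norm_eq_one t) hb θ) (by
    ext p
    exact planeRotation_mem_coordinateSpheres_iff b hst hblock θ p)
  rwa [coe_planeRotationIsometry] at this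

theorem IsInvariantOnSpheres.integrable {b : OrthonormalBasis (ι ⊕ κ) ℝ E} {r : ℝ}
    {μ : Measure E} [IsFiniteMeasure μ] (hμ : IsInvariantOnSpheres b r μ) {f : E → ℝ}
    (hf : ContinuousOn f (coordinateSpheres b r)) : Integrable f μ := by
  have hK := isCompact_coordinateSpheres b r
  have := hf.integrableOn_compact (μ := μ) hK
  rwa [IntegrableOn, Measure.restrict_eq_self_of_ae_mem hμ.ae_mem] at this

/-- Integration by parts: the rotation derivative of the product of `u` and the rotation derivative
of `P` integrates to zero. -/
theorem IsInvariantOnSpheres.integral_rotationDeriv_mul {b : OrthonormalBasis (ι ⊕ κ) ℝ E}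
    {r : ℝ} {μ : Measure E} [IsFiniteMeasure μ] (hμ : IsInvariantOnSpheres b r μ) {U : Set E}
    (hU : IsOpen U) (hKU : coordinateSpheres b r ⊆ U) {s t : ι ⊕ κ}
    (hblock : s.isLeft = t.isLeft) {u : E → ℝ} (hu : ContDiffOn ℝ 1 u U)
    (P : MvPolynomial (ι ⊕ κ) ℝ) :
    ∫ p, rotationDeriv b s t u p * rotationDeriv b s t (polynomialFunction b P) p ∂μ
      = - ∫ p, u p * polynomialFunction b (rotationDerivation s t (rotationDerivation s t P)) p
        ∂μ := by
  set w := polynomialFunction b (rotationDerivation s t P) with hw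
  have hwU : ContDiffOn ℝ 1 w U := (contDiff_polynomialFunction b _).contDiffOn
  have h := hμ.integral_rotationDeriv hU hKU hblock (hu.mul hwU)
  have huK : ContinuousOn u (coordinateSpheres b r) := hu.continuousOn.mono hKU
  have hwK : ContinuousOn w (coordinateSpheres b r) := hwU.continuousOn.mono hKU
  have h1 : Integrable (fun p => rotationDeriv b s t u p * w p) μ :=
    hμ.integrable ((continuousOn_rotationDeriv b hU hKU hu s t).mul hwK)
  have h2 : Integrable (fun p => u p * rotationDeriv b s t w p) μ :=
    hμ.integrable (huK.mul (continuousOn_rotationDeriv b hU hKU hwU s t))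
  have heq : ∫ p, rotationDeriv b s t (fun y => u y * w y) p ∂μ
      = ∫ p, (rotationDeriv b s t u p * w p + u p * rotationDeriv b s t w p) ∂μ := by
    refine integral_congr_ae (hμ.ae_mem.mono fun p hp => ?_)
    exact rotationDeriv_mul b s t
      ((hu.differentiableOn one_ne_zero).differentiableAt (hU.mem_nhds (hKU hp)))
      ((hwU.differentiableOn one_ne_zero).differentiableAt (hU.mem_nhds (hKU hp)))
  rw [heq, integral_add h1 h2] at h
  rw [rotationDeriv_polynomialFunction, ← rotationDeriv_polynomialFunction b s t
    (rotationDerivation s t P)]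
  exact eq_neg_of_add_eq_zero_left h

theorem integral_sum_sum {Ω ν : Type*} [MeasurableSpace Ω] {μ : Measure Ω} [Fintype ν]
    {F : ν → ν → Ω → ℝ} (hF : ∀ i j, Integrable (F i j) μ) :
    Integrable (fun p => ∑ i, ∑ j, F i j p) μ ∧
      ∫ p, ∑ i, ∑ j, F i j p ∂μ = ∑ i, ∑ j, ∫ p, F i j p ∂μ := by
  have hF' : ∀ i, Integrable (fun p => ∑ j, F i j p) μ :=
    fun i => integrable_finsetSum _ fun j _ => hF i j
  refine ⟨integrable_finsetSum _ fun i _ => hF' i, ?_⟩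
  rw [integral_finsetSum _ fun i _ => hF' i]
  exact Finset.sum_congr rfl fun i _ => integral_finsetSum _ fun j _ => hF i j

theorem IsInvariantOnSpheres.integral_sum_rotationDeriv_mul {b : OrthonormalBasis (ι ⊕ κ) ℝ E}
    {r : ℝ} {μ : Measure E} [IsFiniteMeasure μ] (hμ : IsInvariantOnSpheres b r μ) {U : Set E}
    (hU : IsOpen U) (hKU : coordinateSpheres b r ⊆ U) {u : E → ℝ} (hu : ContDiffOn ℝ 1 u U)
    (P : MvPolynomial (ι ⊕ κ) ℝ) {ν : Type*} [Fintype ν] (f : ν → ι ⊕ κ)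
    (hf : ∀ i j, (f i).isLeft = (f j).isLeft) :
    Integrable (fun p => ∑ i, ∑ j, rotationDeriv b (f i) (f j) u p *
        rotationDeriv b (f i) (f j) (polynomialFunction b P) p) μ ∧
    Integrable (fun p => ∑ i, ∑ j, u p * polynomialFunction b
        (rotationDerivation (f i) (f j) (rotationDerivation (f i) (f j) P)) p) μ ∧
    ∫ p, ∑ i, ∑ j, rotationDeriv b (f i) (f j) u p *
        rotationDeriv b (f i) (f j) (polynomialFunction b P) p ∂μ
      = - ∫ p, ∑ i, ∑ j, u p * polynomialFunction b
        (rotationDerivation (f i) (f j) (rotationDerivation (f i) (f j) P)) p ∂μ := by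
  have hpoly : ∀ Q : MvPolynomial (ι ⊕ κ) ℝ,
      ContinuousOn (polynomialFunction b Q) (coordinateSpheres b r) :=
    fun Q => (contDiff_polynomialFunction b Q (k := 0)).continuous.continuousOn
  have huK : ContinuousOn u (coordinateSpheres b r) := hu.continuousOn.mono hKU
  have h1 : ∀ s t, Integrable (fun p => rotationDeriv b s t u p *
      rotationDeriv b s t (polynomialFunction b P) p) μ := fun s t => hμ.integrable
    ((continuousOn_rotationDeriv b hU hKU hu s t).mul
      (continuousOn_rotationDeriv b hU hKU (contDiff_polynomialFunction b P).contDiffOn s t))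
  have h2 : ∀ s t, Integrable (fun p => u p *
      polynomialFunction b (rotationDerivation s t (rotationDerivation s t P)) p) μ :=
    fun s t => hμ.integrable (huK.mul (hpoly _))
  have a := integral_sum_sum fun i j => h1 (f i) (f j)
  have b' := integral_sum_sum fun i j => h2 (f i) (f j)
  refine ⟨a.1, b'.1, ?_⟩
  rw [a.2, b'.2, ← Finset.sum_neg_distrib]
  refine Finset.sum_congr rfl fun i _ => ?_
  rw [← Finset.sum_neg_distrib]
  exact Finset.sum_congr rfl fun j _ => hμ.integral_rotationDeriv_mul hU hKU (hf i j) hu P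

/-- The weak form of the eigenvalue equation. The test function `u` is only continuously
differentiable; both derivatives fall on the polynomial. -/
theorem IsInvariantOnSpheres.integral_gradientProduct {b : OrthonormalBasis (ι ⊕ κ) ℝ E}
    {r : ℝ} {μ : Measure E} [IsFiniteMeasure μ] (hμ : IsInvariantOnSpheres b r μ) {U : Set E}
    (hU : IsOpen U) (hKU : coordinateSpheres b r ⊆ U) {u : E → ℝ} (hu : ContDiffOn ℝ 1 u U)
    {P : MvPolynomial (ι ⊕ κ) ℝ} {c : ℝ}
    (hP : ∀ x ∈ spherePoints ι κ r, eval x (productLaplacian r P) = c * eval x P) :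
    ∫ p, gradientProduct b r u (polynomialFunction b P) p ∂μ
      = c * ∫ p, u p * polynomialFunction b P p ∂μ := by
  have hL := hμ.integral_sum_rotationDeriv_mul hU hKU hu P (Sum.inl : ι → ι ⊕ κ) fun _ _ => rfl
  have hR := hμ.integral_sum_rotationDeriv_mul hU hKU hu P (Sum.inr : κ → ι ⊕ κ) fun _ _ => rfl
  obtain ⟨a1, b1, e1⟩ := hL
  obtain ⟨a2, b2, e2⟩ := hR
  have hR' : c * ∫ p, u p * polynomialFunction b P p ∂μ
      = ∫ p, u p * polynomialFunction b (productLaplacian r P) p ∂μ := by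
    rw [← integral_const_mul]
    refine integral_congr_ae (hμ.ae_mem.mono fun p hp => ?_)
    simp only [polynomialFunction]
    rw [hP _ hp]
    ring
  have hR'' : ∀ p, u p * polynomialFunction b (productLaplacian r P) p
      = - (1 / (2 * r ^ 2) * (∑ i : ι, ∑ j : ι, u p * polynomialFunction b
          (rotationDerivation (Sum.inl i) (Sum.inl j)
            (rotationDerivation (Sum.inl i) (Sum.inl j) P)) p)
        + 1 / 2 * ∑ i : κ, ∑ j : κ, u p * polynomialFunction b
          (rotationDerivation (Sum.inr i) (Sum.inr j)
            (rotationDerivation (Sum.inr i) (Sum.inr j) P)) p) := by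
    intro p
    simp only [polynomialFunction, productLaplacian_apply, map_neg, map_add, smul_eval, map_sum,
      ← Finset.mul_sum]
    ring
  rw [hR']
  simp only [hR'', gradientProduct]
  rw [integral_neg, integral_add (a1.const_mul _) (a2.const_mul _),
    integral_add (b1.const_mul _) (b2.const_mul _), integral_const_mul, integral_const_mul,
    integral_const_mul, integral_const_mul, e1, e2]
  ring

end ProductOfSpheres

/-! ### Polynomial approximation and the Poincaré inequality -/

section ProductOfSpheres

open MvPolynomial

variable {E : Type*} [NormedAddCommGroup E] [InnerProductSpace ℝ E]
  {ι κ : Type*} [Fintype ι] [Fintype κ]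

/-- Stone–Weierstrass: the coordinate functions separate points. -/
theorem exists_polynomialFunction_near {σ : Type*} [Fintype σ] (b : OrthonormalBasis σ ℝ E)
    {K : Set E} (hK : IsCompact K) {u : E → ℝ} (hu : ContinuousOn u K) {ε : ℝ} (hε : 0 < ε) :
    ∃ P : MvPolynomial σ ℝ, ∀ p ∈ K, |u p - polynomialFunction b P p| < ε := by
  have : CompactSpace K := isCompact_iff_compactSpace.1 hK
  let X' : σ → C(K, ℝ) := fun s => ⟨fun p => inner ℝ (b s) (p : E), by fun_prop⟩
  have heval : ∀ (P : MvPolynomial σ ℝ) (p : K), aeval X' P p = polynomialFunction b P p := by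
    intro P p
    induction P using MvPolynomial.induction_on with
    | C a => simp [polynomialFunction]
    | add P Q hP hQ => rw [map_add, ContinuousMap.add_apply, hP, hQ, polynomialFunction_add]; rfl
    | mul_X P t hP =>
      rw [map_mul, ContinuousMap.mul_apply, hP, polynomialFunction_mul_X, aeval_X]; rfl
  have hsep : (aeval X' : MvPolynomial σ ℝ →ₐ[ℝ] C(K, ℝ)).range.SeparatesPoints := by
    intro p q hpq
    have : ∃ s, inner ℝ (b s) (p : E) ≠ inner ℝ (b s) (q : E) := by
      by_contra! h
      refine hpq (Subtype.ext (b.repr.injective (PiLp.ext fun s => ?_)))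
      rw [b.repr_apply_apply, b.repr_apply_apply, h s]
    obtain ⟨s, hs⟩ := this
    exact ⟨X' s, ⟨X' s, ⟨X s, by simp⟩, rfl⟩, hs⟩
  obtain ⟨⟨_, P, rfl⟩, hg⟩ :=
    ContinuousMap.exists_mem_subalgebra_near_continuous_of_separatesPoints _ hsep
      (fun p : K => u p) hu.domRestrict ε hε
  refine ⟨P, fun p hp => ?_⟩
  have := hg ⟨p, hp⟩
  rw [Real.norm_eq_abs, abs_sub_comm] at this
  rwa [← heval P ⟨p, hp⟩]

theorem rotationDeriv_add {σ : Type*} [Fintype σ] (b : OrthonormalBasis σ ℝ E) (s t : σ)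
    {u v : E → ℝ} {p : E} (hu : DifferentiableAt ℝ u p) (hv : DifferentiableAt ℝ v p) :
    rotationDeriv b s t (u + v) p = rotationDeriv b s t u p + rotationDeriv b s t v p := by
  rw [rotationDeriv, fderiv_add hu hv]; rfl

theorem rotationDeriv_smul {σ : Type*} [Fintype σ] (b : OrthonormalBasis σ ℝ E) (s t : σ)
    {u : E → ℝ} {p : E} (hu : DifferentiableAt ℝ u p) (a : ℝ) :
    rotationDeriv b s t (a • u) p = a * rotationDeriv b s t u p := by
  rw [rotationDeriv, fderiv_const_smul hu]; rfl

theorem gradientProduct_comm (b : OrthonormalBasis (ι ⊕ κ) ℝ E) (r : ℝ) (u v : E → ℝ) :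
    gradientProduct b r u v = gradientProduct b r v u := by
  funext p
  simp only [gradientProduct, mul_comm (rotationDeriv b _ _ u p)]

theorem gradientProduct_self_nonneg (b : OrthonormalBasis (ι ⊕ κ) ℝ E) (r : ℝ) (u : E → ℝ)
    (p : E) : 0 ≤ gradientProduct b r u u p := by
  have h : ∀ s t, 0 ≤ rotationDeriv b s t u p * rotationDeriv b s t u p :=
    fun s t => mul_self_nonneg _
  exact add_nonneg
    (mul_nonneg (by positivity) (Finset.sum_nonneg fun i _ => Finset.sum_nonneg fun j _ => h _ _))
    (mul_nonneg (by positivity) (Finset.sum_nonneg fun i _ => Finset.sum_nonneg fun j _ => h _ _))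

theorem gradientProduct_add_left (b : OrthonormalBasis (ι ⊕ κ) ℝ E) (r : ℝ) {u v : E → ℝ}
    (w : E → ℝ) {p : E} (hu : DifferentiableAt ℝ u p) (hv : DifferentiableAt ℝ v p) :
    gradientProduct b r (u + v) w p = gradientProduct b r u w p + gradientProduct b r v w p := by
  simp only [gradientProduct, rotationDeriv_add b _ _ hu hv, add_mul, Finset.sum_add_distrib]
  ring

theorem gradientProduct_smul_left (b : OrthonormalBasis (ι ⊕ κ) ℝ E) (r : ℝ) {u : E → ℝ}
    (w : E → ℝ) {p : E} (hu : DifferentiableAt ℝ u p) (a : ℝ) :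
    gradientProduct b r (a • u) w p = a * gradientProduct b r u w p := by
  simp only [gradientProduct, rotationDeriv_smul b _ _ hu, mul_assoc, ← Finset.mul_sum]
  ring

/-- The continuously differentiable functions on an open set. -/
def contDiffOnSubmodule (U : Set E) : Submodule ℝ (E → ℝ) where
  carrier := {u | ContDiffOn ℝ 1 u U}
  zero_mem' := contDiffOn_const
  add_mem' := fun hu hv => ContDiffOn.add hu hv
  smul_mem' := fun a _ hu => ContDiffOn.const_smul a hu

variable [FiniteDimensional ℝ E] [MeasurableSpace E] [BorelSpace E]

/-- The bilinear form `∫ u v`. -/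
noncomputable def IsInvariantOnSpheres.l2Form {b : OrthonormalBasis (ι ⊕ κ) ℝ E} {r : ℝ}
    {μ : Measure E} [IsFiniteMeasure μ] (hμ : IsInvariantOnSpheres b r μ) {U : Set E}
    (hKU : coordinateSpheres b r ⊆ U) : LinearMap.BilinForm ℝ (contDiffOnSubmodule U) :=
  have hint : ∀ u v : contDiffOnSubmodule U, Integrable (fun p => u.1 p * v.1 p) μ :=
    fun u v => hμ.integrable ((u.2.continuousOn.mono hKU).mul (v.2.continuousOn.mono hKU))
  LinearMap.mk₂ ℝ (fun u v => ∫ p, u.1 p * v.1 p ∂μ)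
    (fun u v w => by
      rw [← integral_add (hint u w) (hint v w)]
      exact integral_congr_ae (Eventually.of_forall fun p => add_mul _ _ _))
    (fun a u v => by
      rw [smul_eq_mul, ← integral_const_mul]
      exact integral_congr_ae (Eventually.of_forall fun p => mul_assoc _ _ _))
    (fun u v w => by
      rw [← integral_add (hint u v) (hint u w)]
      exact integral_congr_ae (Eventually.of_forall fun p => mul_add _ _ _))
    (fun a u v => by
      rw [smul_eq_mul, ← integral_const_mul]
      exact integral_congr_ae (Eventually.of_forall fun p => mul_left_comm _ _ _))

/-- The Dirichlet form `∫ ⟨∇u, ∇v⟩`. -/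
noncomputable def IsInvariantOnSpheres.dirichletForm {b : OrthonormalBasis (ι ⊕ κ) ℝ E} {r : ℝ}
    {μ : Measure E} [IsFiniteMeasure μ] (hμ : IsInvariantOnSpheres b r μ) {U : Set E}
    (hU : IsOpen U) (hKU : coordinateSpheres b r ⊆ U) :
    LinearMap.BilinForm ℝ (contDiffOnSubmodule U) :=
  have hint : ∀ u v : contDiffOnSubmodule U, Integrable (gradientProduct b r u.1 v.1) μ :=
    fun u v => hμ.integrable (continuousOn_gradientProduct b r hU hKU u.2 v.2)
  have hd : ∀ u : contDiffOnSubmodule U, ∀ p ∈ coordinateSpheres b r, DifferentiableAt ℝ u.1 p :=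
    fun u p hp => (u.2.differentiableOn one_ne_zero).differentiableAt (hU.mem_nhds (hKU hp))
  LinearMap.mk₂ ℝ (fun u v => ∫ p, gradientProduct b r u.1 v.1 p ∂μ)
    (fun u v w => by
      rw [← integral_add (hint u w) (hint v w)]
      exact integral_congr_ae (hμ.ae_mem.mono fun p hp =>
        gradientProduct_add_left b r w.1 (hd u p hp) (hd v p hp)))
    (fun a u v => by
      rw [smul_eq_mul, ← integral_const_mul]
      exact integral_congr_ae (hμ.ae_mem.mono fun p hp =>
        gradientProduct_smul_left b r v.1 (hd u p hp) a))
    (fun u v w => by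
      rw [← integral_add (hint u v) (hint u w)]
      simp only [gradientProduct_comm b r u.1]
      exact integral_congr_ae (hμ.ae_mem.mono fun p hp =>
        gradientProduct_add_left b r u.1 (hd v p hp) (hd w p hp)))
    (fun a u v => by
      rw [smul_eq_mul, ← integral_const_mul]
      simp only [gradientProduct_comm b r u.1]
      exact integral_congr_ae (hμ.ae_mem.mono fun p hp =>
        gradientProduct_smul_left b r u.1 (hd v p hp) a))

/-- The Poincaré inequality on a product of two spheres. -/
theorem IsInvariantOnSpheres.poincare {b : OrthonormalBasis (ι ⊕ κ) ℝ E} {r : ℝ}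
    {μ : Measure E} [IsFiniteMeasure μ] (hμ : IsInvariantOnSpheres b r μ)
    (hι : 2 ≤ Fintype.card ι) (hκ : 2 ≤ Fintype.card κ) (hr : r ≠ 0) {l : ℝ} (hl : 0 ≤ l)
    (hl1 : l ≤ (Fintype.card ι - 1) / r ^ 2) (hl2 : l ≤ Fintype.card κ - 1) {U : Set E}
    (hU : IsOpen U) (hKU : coordinateSpheres b r ⊆ U) {u : E → ℝ} (hu : ContDiffOn ℝ 1 u U)
    (hu0 : ∫ p, u p ∂μ = 0) :
    l * ∫ p, u p ^ 2 ∂μ ≤ ∫ p, gradientProduct b r u u p ∂μ := by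
  set I := hμ.l2Form hKU with hI
  set D := hμ.dirichletForm hU hKU with hD
  have hIapp : ∀ v w, I v w = ∫ p, v.1 p * w.1 p ∂μ := fun v w => rfl
  have hDapp : ∀ v w, D v w = ∫ p, gradientProduct b r v.1 w.1 p ∂μ := fun v w => rfl
  have hIs : ∀ v w, I v w = I w v := fun v w => by
    rw [hIapp, hIapp]; simp only [mul_comm]
  have hDs : ∀ v w, D v w = D w v := fun v w => by
    rw [hDapp, hDapp, gradientProduct_comm]
  have hI0 : ∀ v, 0 ≤ I v v := fun v => integral_nonneg fun p => mul_self_nonneg _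
  have hD0 : ∀ v, 0 ≤ D v v := fun v => integral_nonneg fun p =>
    gradientProduct_self_nonneg b r v.1 p
  let F : MvPolynomial (ι ⊕ κ) ℝ → contDiffOnSubmodule U := fun P =>
    ⟨polynomialFunction b P, (contDiff_polynomialFunction b P).contDiffOn⟩
  let u' : contDiffOnSubmodule U := ⟨u, hu⟩
  -- The inequality up to an error of order ε², from a polynomial uniformly within ε of `u`; only
  -- values, not derivatives, are approximated.
  have hmain : ∀ ε > 0, l * (I u' u' - ε ^ 2 * μ.real Set.univ) ≤ D u' u' := by
    intro ε hε
    obtain ⟨P, hP⟩ := exists_polynomialFunction_near b (isCompact_coordinateSpheres b r)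
      (hu.continuousOn.mono hKU) hε
    obtain ⟨s, e, he, hsum⟩ := exists_eq_sum_eigenpolynomials hι hκ hr hl1 hl2 P
    have heig : ∀ k ∈ s, ∀ v, D v (F (e k)) = k * I v (F (e k)) := fun k _ v =>
      hμ.integral_gradientProduct hU hKU v.2 (he k).1
    have horth : ∀ j ∈ s, ∀ k ∈ s, j ≠ k → I (F (e j)) (F (e k)) = 0 := by
      intro j hj k hk hjk
      have h1 := heig k hk (F (e j))
      rw [hDs, heig j hj, hIs] at h1
      have h2 : (j - k) * I (F (e j)) (F (e k)) = 0 := by rw [sub_mul, h1, sub_self]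
      exact (mul_eq_zero.1 h2).resolve_left (sub_ne_zero.2 hjk)
    -- Components with eigenvalue below `l` are constant on the spheres, hence orthogonal to `u`,
    -- which has mean zero.
    have hc : ∀ k ∈ s, l ≤ k ∨ I u' (F (e k)) = 0 := by
      intro k _
      refine or_iff_not_imp_left.2 fun hk => ?_
      obtain ⟨a, ha⟩ := (he k).2 (not_le.1 hk)
      have : I u' (F (e k)) = ∫ p, u p * a ∂μ :=
        integral_congr_ae (hμ.ae_mem.mono fun p hp => by
          change u p * polynomialFunction b (e k) p = u p * a
          rw [polynomialFunction, ha _ hp])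
      rw [this, integral_mul_const, hu0, zero_mul]
    have key := poincare_of_eigenvectors hIs hI0 hDs hD0 s (fun k => F (e k)) id horth heig hl u' hc
    refine le_trans (mul_le_mul_of_nonneg_left ?_ hl) key
    have hFsum : ∑ k ∈ s, F (e k) = F P := by
      apply Subtype.ext
      rw [Submodule.coe_sum]
      funext p
      simp only [F, ← hsum, Finset.sum_apply, polynomialFunction, map_sum]
    rw [hFsum]
    refine sub_le_sub_left ?_ _
    rw [hIapp]
    calc ∫ p, (u' - F P).1 p * (u' - F P).1 p ∂μ ≤ ∫ _, ε ^ 2 ∂μ := by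
          refine integral_mono_ae ?_ (integrable_const _) (hμ.ae_mem.mono fun p hp => ?_)
          · exact hμ.integrable (((u' - F P).2.continuousOn.mono hKU).mul
              ((u' - F P).2.continuousOn.mono hKU))
          · have := (hP p hp).le
            change (u p - polynomialFunction b P p) * (u p - polynomialFunction b P p) ≤ ε ^ 2
            rw [← sq]
            exact sq_le_sq' (abs_le.1 this).1 (abs_le.1 this).2
      _ = ε ^ 2 * μ.real Set.univ := by rw [integral_const, smul_eq_mul, mul_comm]
  have hlim : Tendsto (fun ε : ℝ => l * (I u' u' - ε ^ 2 * μ.real Set.univ)) (𝓝[>] 0)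
      (𝓝 (l * (I u' u' - 0 ^ 2 * μ.real Set.univ))) :=
    ((Continuous.tendsto (by fun_prop) 0).mono_left nhdsWithin_le_nhds)
  have := le_of_tendsto hlim (eventually_nhdsWithin_of_forall fun ε hε => hmain ε hε)
  rw [hIapp, hDapp] at this
  simpa [sq, u'] using this

end ProductOfSpheres

/-! ### Tangent spaces and derivatives along subsets of Euclidean space -/

namespace EuclideanSubmanifold

section General

variable {E : Type*} [NormedAddCommGroup E] [InnerProductSpace ℝ E]

theorem mem_tangentSpaceAt_of_curve {M : Set E} {c : ℝ → E} {v : E} (hc : HasDerivAt c v 0)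
    (hM : ∀ t, c t ∈ M) : v ∈ tangentSpaceAt M (c 0) := by
  apply Submodule.subset_span
  have h := hc.hasFDerivAt.hasFDerivWithinAt (s := Set.univ)
  have h1 := h.mapsTo_tangent_cone (show (1 : ℝ) ∈ tangentConeAt ℝ Set.univ 0 by simp)
  have h2 : c '' Set.univ ⊆ M := by rintro _ ⟨t, -, rfl⟩; exact hM t
  simpa using tangentConeAt_mono h2 h1

/-- A derivative within `M` is not unique as a linear map, so `fderivWithin` is an arbitrary choice;
all choices agree on the span of the tangent cone. This allows computing with any convenient
derivative. -/
theorem apply_eq_of_hasFDerivWithinAt {F : Type*} [NormedAddCommGroup F] [NormedSpace ℝ F]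
    {M : Set E} {f : E → F} {f' f₁' : E →L[ℝ] F} {p v : E} (h : HasFDerivWithinAt f f' M p)
    (h₁ : HasFDerivWithinAt f f₁' M p) (hv : v ∈ tangentSpaceAt M p) : f' v = f₁' v :=
  LinearMap.eqOn_span (f := (f' : E →ₗ[ℝ] F)) (g := (f₁' : E →ₗ[ℝ] F)) (h.unique_on h₁) hv

theorem tangentSpaceAt_le_ker_of_const {F : Type*} [NormedAddCommGroup F] [NormedSpace ℝ F]
    {M : Set E} {f : E → F} {f' : E →L[ℝ] F} {p v : E} (h : HasFDerivAt f f' p) {a : F}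
    (hf : ∀ q ∈ M, f q = a) (hp : p ∈ M) (hv : v ∈ tangentSpaceAt M p) : f' v = 0 := by
  have h1 : HasFDerivWithinAt f (0 : E →L[ℝ] F) M p :=
    (hasFDerivWithinAt_const a p M).congr hf (hf p hp)
  simpa using apply_eq_of_hasFDerivWithinAt h.hasFDerivWithinAt h1 hv

/-- Radial projection of the line x + t v. As v is orthogonal to x, the norm of x + t v is
stationary at t = 0, so rescaling does not change the velocity. -/
theorem exists_curve_in_sphere {x v : E} (hx : x ≠ 0) (hxv : inner ℝ v x = 0) :
    ∃ c : ℝ → E, c 0 = x ∧ HasDerivAt c v 0 ∧ ∀ t, ‖c t‖ = ‖x‖ := by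
  have hpos : ∀ t : ℝ, 0 < ‖x‖ ^ 2 + t ^ 2 * ‖v‖ ^ 2 := fun t => by
    have : 0 < ‖x‖ := norm_pos_iff.2 hx
    positivity
  have hx0 : 0 < ‖x‖ := norm_pos_iff.2 hx
  have hnorm : ∀ t : ℝ, ‖x + t • v‖ = Real.sqrt (‖x‖ ^ 2 + t ^ 2 * ‖v‖ ^ 2) := fun t => by
    rw [eq_comm, Real.sqrt_eq_iff_mul_self_eq (hpos t).le (norm_nonneg _), ← sq,
      norm_add_sq_real, real_inner_smul_right, real_inner_comm, hxv, norm_smul, mul_pow,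
      Real.norm_eq_abs, sq_abs]
    ring
  refine ⟨fun t => (‖x‖ / Real.sqrt (‖x‖ ^ 2 + t ^ 2 * ‖v‖ ^ 2)) • (x + t • v), ?_, ?_, ?_⟩
  · simp [hx]
  · have h1 : HasDerivAt (fun t : ℝ => ‖x‖ ^ 2 + t ^ 2 * ‖v‖ ^ 2) 0 0 := by
      have := (((hasDerivAt_id (0 : ℝ)).pow 2).mul_const (‖v‖ ^ 2)).const_add (‖x‖ ^ 2)
      simpa using this
    have h2 := h1.sqrt (hpos 0).ne'
    have h3 := (hasDerivAt_const (0 : ℝ) ‖x‖).div h2 (Real.sqrt_pos.2 (hpos 0)).ne'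
    have h4 : HasDerivAt (fun t : ℝ => x + t • v) v 0 := by
      simpa using ((hasDerivAt_id (0 : ℝ)).smul_const v).const_add x
    have h5 := h3.smul h4
    refine h5.congr_deriv ?_
    simp [hx]
  · intro t
    rw [norm_smul, hnorm, norm_div, Real.norm_of_nonneg (norm_nonneg x),
      Real.norm_of_nonneg (Real.sqrt_nonneg _), div_mul_cancel₀]
    exact (Real.sqrt_pos.2 (hpos t)).ne'

variable [FiniteDimensional ℝ E]

theorem sum_inner_stdOrthonormalBasis_sq (T : Submodule ℝ E) (w : E) :
    ∑ i, inner ℝ (stdOrthonormalBasis ℝ T i : E) w ^ 2 = ‖T.starProjection w‖ ^ 2 := by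
  rw [Submodule.starProjection_apply, ← Submodule.coe_norm,
    ← (stdOrthonormalBasis ℝ T).sum_sq_norm_inner_right]
  refine Finset.sum_congr rfl fun i _ => ?_
  rw [Real.norm_eq_abs, sq_abs, Submodule.inner_orthogonalProjectionOnto_eq_of_mem_left]

theorem leviCivita_eq_zero_of_const {M : Set E} {X Y : E → E} {a : E} (hY : ∀ q ∈ M, Y q = a)
    {p : E} (hp : p ∈ M) : leviCivita M X Y p = 0 := by
  rw [leviCivita, fderivWithin_congr hY (hY p hp)]
  simp

theorem riemannCurvature_eq_zero_of_const {M : Set E} {p x y z a : E} (hp : p ∈ M)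
    (hz : ∀ q ∈ M, tangentExtension M z q = a) : riemannCurvature M p x y z = 0 := by
  rw [riemannCurvature, curvatureField,
    leviCivita_eq_zero_of_const (a := 0) (fun q hq => leviCivita_eq_zero_of_const hz hq) hp,
    leviCivita_eq_zero_of_const (a := 0) (fun q hq => leviCivita_eq_zero_of_const hz hq) hp,
    leviCivita_eq_zero_of_const hz hp]
  simp

theorem ricci_eq_zero_of_const {M : Set E} {p v a : E} (hp : p ∈ M)
    (hv : ∀ q ∈ M, tangentExtension M v q = a) : ricci M p v = 0 := by
  rw [ricci]
  exact Finset.sum_eq_zero fun i _ => by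
    rw [riemannCurvature_eq_zero_of_const hp hv, inner_zero_left]

theorem surfaceGradient_mem (M : Set E) (u : E → ℝ) (p : E) :
    surfaceGradient M u p ∈ tangentSpaceAt M p :=
  Submodule.starProjection_apply_mem _ _

theorem inner_surfaceGradient {M : Set E} {u : E → ℝ} {u' : E →L[ℝ] ℝ} {p v : E}
    (hu : HasFDerivWithinAt u u' M p) (hv : v ∈ tangentSpaceAt M p) :
    inner ℝ (surfaceGradient M u p) v = u' v := by
  rw [surfaceGradient, tangentProj, Submodule.inner_starProjection_left_eq_right,
    Submodule.starProjection_eq_self_iff.2 hv, gradientWithin, InnerProductSpace.toDual_symm_apply]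
  exact apply_eq_of_hasFDerivWithinAt hu.differentiableWithinAt.hasFDerivWithinAt hu hv

end General

end EuclideanSubmanifold


/-! ### Tangent spaces and horizontal Ricci curvature -/

section Ambient

variable {n m : ℕ}

theorem mem_tangentSpaceAt_euclideanTimesSphere {p v : AmbientSpace n m}
    (hp : p ∈ euclideanTimesSphere n m) :
    v ∈ tangentSpaceAt (euclideanTimesSphere n m) p ↔ inner ℝ v.snd p.snd = 0 := by
  constructor
  · intro hv
    have h : HasFDerivAt (fun q : AmbientSpace n m => ‖q.snd‖ ^ 2) _ p :=
      (WithLp.sndL 2 ℝ (EuclideanSpace ℝ (Fin n)) (EuclideanSpace ℝ (Fin (m + 1)))).hasFDerivAt.norm_sq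
    have h1 := tangentSpaceAt_le_ker_of_const h (a := 1) (fun q hq => by
      rw [show ‖q.snd‖ = 1 from hq, one_pow]) hp hv
    rw [real_inner_comm]
    simpa using h1
  · intro hv
    have hp0 : p.snd ≠ 0 := by
      rw [← norm_pos_iff, show ‖p.snd‖ = 1 from hp]; exact one_pos
    obtain ⟨c, hc0, hc, hcn⟩ := exists_curve_in_sphere hp0 hv
    have h1 : HasDerivAt (fun t : ℝ => p.fst + t • v.fst) v.fst 0 := by
      simpa using ((hasDerivAt_id (0 : ℝ)).smul_const v.fst).const_add p.fst
    have h2 := ((WithLp.prodContinuousLinearEquiv 2 ℝ (EuclideanSpace ℝ (Fin n))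
      (EuclideanSpace ℝ (Fin (m + 1)))).symm.hasFDerivAt.comp_hasDerivAt 0 (h1.prodMk hc))
    have h3 := mem_tangentSpaceAt_of_curve (M := euclideanTimesSphere n m) h2
      (fun t => (hcn t).trans hp)
    simpa [hc0] using! h3

/-- Tangent vectors annihilate the differentials of the defining functions; conversely a pair of
curves in the two spheres realizes each such vector. -/
theorem mem_tangentSpaceAt_sphereTimesSphere {r : ℝ} (hr : 0 < r) {p v : AmbientSpace n m}
    (hp : p ∈ sphereTimesSphere n m r) :
    v ∈ tangentSpaceAt (sphereTimesSphere n m r) p ↔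
      inner ℝ v.fst p.fst = 0 ∧ inner ℝ v.snd p.snd = 0 := by
  constructor
  · intro hv
    have h : HasFDerivAt (fun q : AmbientSpace n m => ‖q.fst‖ ^ 2) _ p :=
      (WithLp.fstL 2 ℝ (EuclideanSpace ℝ (Fin n)) (EuclideanSpace ℝ (Fin (m + 1)))).hasFDerivAt.norm_sq
    have h' : HasFDerivAt (fun q : AmbientSpace n m => ‖q.snd‖ ^ 2) _ p :=
      (WithLp.sndL 2 ℝ (EuclideanSpace ℝ (Fin n)) (EuclideanSpace ℝ (Fin (m + 1)))).hasFDerivAt.norm_sq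
    have h1 := tangentSpaceAt_le_ker_of_const h (a := r ^ 2) (fun q hq => by rw [hq.1]) hp hv
    have h2 := tangentSpaceAt_le_ker_of_const h' (a := 1) (fun q hq => by rw [hq.2, one_pow]) hp hv
    rw [real_inner_comm, real_inner_comm p.snd]
    exact ⟨by simpa using h1, by simpa using h2⟩
  · rintro ⟨hv, hv'⟩
    have hp0 : p.snd ≠ 0 := by
      rw [← norm_pos_iff, hp.2]; exact one_pos
    have hp1 : p.fst ≠ 0 := by
      rw [← norm_pos_iff, hp.1]; exact hr
    obtain ⟨c, hc0, hc, hcn⟩ := exists_curve_in_sphere hp0 hv'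
    obtain ⟨d, hd0, hd, hdn⟩ := exists_curve_in_sphere hp1 hv
    have h2 := ((WithLp.prodContinuousLinearEquiv 2 ℝ (EuclideanSpace ℝ (Fin n))
      (EuclideanSpace ℝ (Fin (m + 1)))).symm.hasFDerivAt.comp_hasDerivAt 0 (hd.prodMk hc))
    have h3 := mem_tangentSpaceAt_of_curve (M := sphereTimesSphere n m r) h2
      (fun t => ⟨(hdn t).trans hp.1, (hcn t).trans hp.2⟩)
    simpa [hc0, hd0] using! h3

/-- A horizontal vector is tangent at every point, so its tangent extension is constant, hence
parallel. -/
theorem ricci_euclideanTimesSphere {p : AmbientSpace n m} (hp : p ∈ euclideanTimesSphere n m)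
    {v : AmbientSpace n m} (hv : v.snd = 0) : ricci (euclideanTimesSphere n m) p v = 0 := by
  refine ricci_eq_zero_of_const (a := v) hp fun q hq => ?_
  rw [tangentExtension, tangentProj, Submodule.starProjection_eq_self_iff,
    mem_tangentSpaceAt_euclideanTimesSphere hq, hv, inner_zero_left]

end Ambient

/-! ### Normal fields, second fundamental form and index form -/

section Ambient

variable {n m : ℕ}

/-- The projection `ℝ^n × ℝ^(m+1) → ℝ^n × 0`. -/
noncomputable def horizontalPart (n m : ℕ) : AmbientSpace n m →L[ℝ] AmbientSpace n m :=
  (WithLp.prodContinuousLinearEquiv 2 ℝ (EuclideanSpace ℝ (Fin n))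
    (EuclideanSpace ℝ (Fin (m + 1)))).symm.toContinuousLinearMap ∘L
    (ContinuousLinearMap.inl ℝ _ _) ∘L
    (WithLp.fstL 2 ℝ (EuclideanSpace ℝ (Fin n)) (EuclideanSpace ℝ (Fin (m + 1))))

theorem fst_horizontalPart (v : AmbientSpace n m) : (horizontalPart n m v).fst = v.fst := rfl

theorem snd_horizontalPart (v : AmbientSpace n m) : (horizontalPart n m v).snd = 0 := rfl

theorem inner_ambient (v w : AmbientSpace n m) :
    inner ℝ v w = inner ℝ v.fst w.fst + inner ℝ v.snd w.snd := rfl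

theorem inner_horizontalPart_left (v w : AmbientSpace n m) :
    inner ℝ (horizontalPart n m v) w = inner ℝ v.fst w.fst := by
  rw [inner_ambient, fst_horizontalPart, snd_horizontalPart, inner_zero_left, add_zero]

theorem norm_horizontalPart (v : AmbientSpace n m) : ‖horizontalPart n m v‖ = ‖v.fst‖ := by
  rw [← sq_eq_sq₀ (norm_nonneg _) (norm_nonneg _), ← real_inner_self_eq_norm_sq,
    inner_horizontalPart_left, fst_horizontalPart, real_inner_self_eq_norm_sq]

theorem sphereTimesSphere_subset (r : ℝ) :
    sphereTimesSphere n m r ⊆ euclideanTimesSphere n m := fun _ hp => hp.2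

/-- This is the trace of the horizontal projection on the tangent space. Exchanging the sums turns
it into ∑ |proj f_a|² = ∑ (1 - x_a²/r²) = n - 1 over the standard basis f_a of ℝ^n. -/
theorem sum_norm_fst_stdOrthonormalBasis {r : ℝ} (hr : 0 < r) {p : AmbientSpace n m}
    (hp : p ∈ sphereTimesSphere n m r) :
    ∑ i, ‖(stdOrthonormalBasis ℝ (tangentSpaceAt (sphereTimesSphere n m r) p) i :
      AmbientSpace n m).fst‖ ^ 2 = (n : ℝ) - 1 := by
  set T := tangentSpaceAt (sphereTimesSphere n m r) p with hT
  set f : Fin n → AmbientSpace n m := fun a =>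
    WithLp.toLp 2 (EuclideanSpace.basisFun (Fin n) ℝ a, 0) with hf
  have hfst : ∀ v : AmbientSpace n m, ‖v.fst‖ ^ 2 = ∑ a, inner ℝ v (f a) ^ 2 := by
    intro v
    rw [← (EuclideanSpace.basisFun (Fin n) ℝ).sum_sq_norm_inner_left]
    refine Finset.sum_congr rfl fun a _ => ?_
    rw [Real.norm_eq_abs, sq_abs, inner_ambient]
    simp [hf]
  have hproj : ∀ a, ‖T.starProjection (f a)‖ ^ 2 = 1 - (p.fst a / r) ^ 2 := by
    intro a
    have hpr : inner ℝ p.fst p.fst = r ^ 2 := by rw [real_inner_self_eq_norm_sq, hp.1]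
    have h1 : T.starProjection (f a) = f a - (p.fst a / r ^ 2) • horizontalPart n m p := by
      refine Submodule.eq_starProjection_of_mem_of_inner_eq_zero ?_ fun w hw => ?_
      · rw [hT, mem_tangentSpaceAt_sphereTimesSphere hr hp]
        constructor
        · change inner ℝ (EuclideanSpace.basisFun (Fin n) ℝ a - (p.fst a / r ^ 2) • p.fst) p.fst = 0
          rw [inner_sub_left, real_inner_smul_left, hpr, div_mul_cancel₀ _ (by positivity)]
          simp [EuclideanSpace.inner_single_left]
        · change inner ℝ ((0 : EuclideanSpace ℝ (Fin (m + 1))) - (p.fst a / r ^ 2) • 0) p.snd = 0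
          simp
      · rw [hT, mem_tangentSpaceAt_sphereTimesSphere hr hp] at hw
        rw [sub_sub_cancel, real_inner_smul_left, inner_horizontalPart_left, real_inner_comm, hw.1,
          mul_zero]
    have hfn : ‖f a‖ ^ 2 = 1 := by
      rw [← real_inner_self_eq_norm_sq, inner_ambient]; simp [hf]
    have hfp : inner ℝ (f a) (horizontalPart n m p) = p.fst a := by
      rw [real_inner_comm, inner_horizontalPart_left]
      simp [hf, EuclideanSpace.inner_single_right]
    rw [h1, norm_sub_sq_real, real_inner_smul_right, hfp, norm_smul, norm_horizontalPart, hp.1,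
      mul_pow, Real.norm_eq_abs, sq_abs, hfn]
    field_simp
    ring
  simp only [hfst]
  rw [Finset.sum_comm]
  simp only [sum_inner_stdOrthonormalBasis_sq, hproj, Finset.sum_sub_distrib, div_pow,
    ← Finset.sum_div]
  have : ∑ a, p.fst a ^ 2 = r ^ 2 := by rw [← hp.1, EuclideanSpace.real_norm_sq_eq]
  rw [this, div_self (by positivity)]
  simp

/-- The unit normal fields of `S^(n-1)(r) × S^m` and their derivatives. -/
theorem unitNormalField_sphereTimesSphere {r : ℝ} (hr : 0 < r) {N : AmbientSpace n m → AmbientSpace n m}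
    (hN : IsUnitNormalField (euclideanTimesSphere n m) (sphereTimesSphere n m r) N)
    {p : AmbientSpace n m} (hp : p ∈ sphereTimesSphere n m r) :
    ∃ s : ℝ, s ^ 2 = 1 ∧ N p = (s / r) • horizontalPart n m p ∧
      ∀ v ∈ tangentSpaceAt (sphereTimesSphere n m r) p,
        fderivWithin ℝ N (sphereTimesSphere n m r) p v = (s / r) • horizontalPart n m v := by
  set S := sphereTimesSphere n m r with hS
  set s : AmbientSpace n m → ℝ := fun q => inner ℝ (N q) (r⁻¹ • horizontalPart n m q) with hs
  have hnn : ∀ q ∈ S, inner ℝ (horizontalPart n m q) (horizontalPart n m q) = r ^ 2 := by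
    intro q hq
    rw [real_inner_self_eq_norm_sq, norm_horizontalPart, hq.1]
  have hNs : ∀ q ∈ S, N q = (s q / r) • horizontalPart n m q := by
    intro q hq
    have ht := (mem_tangentSpaceAt_euclideanTimesSphere (sphereTimesSphere_subset r hq)).1
      (hN.tangent q hq)
    -- What remains of `N` after removing its radial component is tangent to the hypersurface, so it
    -- is orthogonal to `N` as well as to the radial vector, hence zero.
    set w := N q - (s q / r) • horizontalPart n m q with hw
    have hwq : inner ℝ w (horizontalPart n m q) = 0 := by
      rw [hw, inner_sub_left, real_inner_smul_left, hnn q hq, hs]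
      simp only [real_inner_smul_right]
      field_simp
      ring
    have hwT : w ∈ tangentSpaceAt S q := by
      rw [mem_tangentSpaceAt_sphereTimesSphere hr hq]
      constructor
      · rw [real_inner_comm, ← inner_horizontalPart_left, real_inner_comm, hwq]
      · change inner ℝ ((N q).snd - (s q / r) • (0 : EuclideanSpace ℝ (Fin (m + 1)))) q.snd = 0
        rw [smul_zero, sub_zero, ht]
    have h0 : inner ℝ w w = 0 := by
      conv_lhs => arg 2; rw [hw]
      rw [inner_sub_left, hN.normal q hq w hwT, real_inner_smul_left, real_inner_comm, hwq]
      simp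
    exact sub_eq_zero.1 (inner_self_eq_zero.1 h0)
  have hs1 : ∀ q ∈ S, s q ^ 2 = 1 := by
    intro q hq
    have h := hN.unit q hq
    rw [hNs q hq, norm_smul, norm_horizontalPart, hq.1, norm_div, Real.norm_of_nonneg hr.le,
      div_mul_cancel₀ _ hr.ne', Real.norm_eq_abs] at h
    rw [← sq_abs, h, one_pow]
  refine ⟨s p, hs1 p hp, hNs p hp, fun v hv => ?_⟩
  have hNd : DifferentiableWithinAt ℝ N S p :=
    (hN.smooth.differentiableOn (by simp)) p hp
  have hsd : DifferentiableWithinAt ℝ s S p :=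
    hNd.inner ℝ ((horizontalPart n m).differentiableAt.const_smul r⁻¹).differentiableWithinAt
  obtain ⟨s', hs'⟩ := hsd
  -- Differentiating s² = 1 shows that the sign is stationary; connectedness of the hypersurface
  -- plays no role.
  have hds : s' v = 0 := by
    have h1 : HasFDerivWithinAt (fun q => s q ^ 2) (0 : AmbientSpace n m →L[ℝ] ℝ) S p :=
      (hasFDerivWithinAt_const (1 : ℝ) p S).congr hs1 (hs1 p hp)
    have h2 := apply_eq_of_hasFDerivWithinAt (hs'.pow 2) h1 hv
    have h3 : s p ≠ 0 := fun h => by simpa [h] using hs1 p hp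
    simpa [h3] using h2
  have h1 : HasFDerivWithinAt N _ S p :=
    ((hs'.mul_const r⁻¹).smul (horizontalPart n m).hasFDerivWithinAt).congr
      (fun q hq => by rw [hNs q hq, div_eq_mul_inv]; rfl) (by rw [hNs p hp, div_eq_mul_inv]; rfl)
  rw [apply_eq_of_hasFDerivWithinAt hNd.hasFDerivWithinAt h1 hv]
  simp [hds, div_eq_mul_inv]

theorem normSqSecondFundamentalForm_sphereTimesSphere {r : ℝ} (hr : 0 < r)
    {N : AmbientSpace n m → AmbientSpace n m}
    (hN : IsUnitNormalField (euclideanTimesSphere n m) (sphereTimesSphere n m r) N)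
    {p : AmbientSpace n m} (hp : p ∈ sphereTimesSphere n m r) :
    normSqSecondFundamentalForm (sphereTimesSphere n m r) N p = ((n : ℝ) - 1) / r ^ 2 := by
  obtain ⟨s, hs, -, hd⟩ := unitNormalField_sphereTimesSphere hr hN hp
  set T := tangentSpaceAt (sphereTimesSphere n m r) p with hT
  have hterm : ∀ i j, secondFundamentalForm (sphereTimesSphere n m r) N p
      (stdOrthonormalBasis ℝ T i : AmbientSpace n m) (stdOrthonormalBasis ℝ T j) ^ 2
      = 1 / r ^ 2 * inner ℝ (stdOrthonormalBasis ℝ T j : AmbientSpace n m)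
        (horizontalPart n m (stdOrthonormalBasis ℝ T i)) ^ 2 := by
    intro i j
    rw [secondFundamentalForm, hd _ (stdOrthonormalBasis ℝ T i).2, real_inner_smul_left,
      real_inner_comm, neg_sq, mul_pow, div_pow, hs]
  have hproj : ∀ i, ‖T.starProjection (horizontalPart n m (stdOrthonormalBasis ℝ T i))‖ ^ 2
      = ‖(stdOrthonormalBasis ℝ T i : AmbientSpace n m).fst‖ ^ 2 := by
    intro i
    have hi := (mem_tangentSpaceAt_sphereTimesSphere hr hp).1 (stdOrthonormalBasis ℝ T i).2
    have hmem : horizontalPart n m (stdOrthonormalBasis ℝ T i) ∈ T :=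
      (mem_tangentSpaceAt_sphereTimesSphere hr hp).2 ⟨hi.1, inner_zero_left _⟩
    rw [Submodule.starProjection_eq_self_iff.2 hmem, norm_horizontalPart]
  have htr : ∑ i, ‖(stdOrthonormalBasis ℝ T i : AmbientSpace n m).fst‖ ^ 2 = (n : ℝ) - 1 :=
    sum_norm_fst_stdOrthonormalBasis hr hp
  change ∑ i, ∑ j, secondFundamentalForm (sphereTimesSphere n m r) N p
      (stdOrthonormalBasis ℝ T i : AmbientSpace n m) (stdOrthonormalBasis ℝ T j) ^ 2 = _
  simp only [hterm, ← Finset.mul_sum, sum_inner_stdOrthonormalBasis_sq, hproj, htr]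
  ring

/-- The inward normal: with the convention B = -⟨∇N, ·⟩ it makes the mean curvature positive. -/
theorem isUnitNormalField_sphereTimesSphere {r : ℝ} (hr : 0 < r) :
    IsUnitNormalField (euclideanTimesSphere n m) (sphereTimesSphere n m r)
      fun q => (-r⁻¹) • horizontalPart n m q where
  smooth := (ContDiff.const_smul _ (horizontalPart n m).contDiff).contDiffOn
  tangent := fun q hq => by
    refine Submodule.smul_mem _ _ ?_
    rw [mem_tangentSpaceAt_euclideanTimesSphere (sphereTimesSphere_subset r hq),
      snd_horizontalPart, inner_zero_left]
  normal := fun q hq v hv => by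
    rw [real_inner_smul_left, inner_horizontalPart_left, real_inner_comm,
      ((mem_tangentSpaceAt_sphereTimesSphere hr hq).1 hv).1, mul_zero]
  unit := fun q hq => by
    rw [norm_smul, norm_horizontalPart, hq.1, norm_neg, norm_inv, Real.norm_of_nonneg hr.le,
      inv_mul_cancel₀ hr.ne']

theorem hasConstantMeanCurvature_sphereTimesSphere {r : ℝ} (hr : 0 < r) :
    HasConstantMeanCurvature (euclideanTimesSphere n m) (sphereTimesSphere n m r)
      (((n : ℝ) - 1) / r) := by
  refine ⟨_, isUnitNormalField_sphereTimesSphere hr, fun p hp => ?_⟩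
  set T := tangentSpaceAt (sphereTimesSphere n m r) p with hT
  have hterm : ∀ i, secondFundamentalForm (sphereTimesSphere n m r)
      (fun q => (-r⁻¹) • horizontalPart n m q) p
      (stdOrthonormalBasis ℝ T i : AmbientSpace n m) (stdOrthonormalBasis ℝ T i)
      = r⁻¹ * ‖(stdOrthonormalBasis ℝ T i : AmbientSpace n m).fst‖ ^ 2 := by
    intro i
    have h1 : HasFDerivWithinAt (fun q => (-r⁻¹) • horizontalPart n m q) _
      (sphereTimesSphere n m r) p := (horizontalPart n m).hasFDerivWithinAt.const_smul (-r⁻¹)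
    rw [secondFundamentalForm, apply_eq_of_hasFDerivWithinAt
      h1.differentiableWithinAt.hasFDerivWithinAt h1 (stdOrthonormalBasis ℝ T i).2]
    change - inner ℝ ((-r⁻¹) • horizontalPart n m (stdOrthonormalBasis ℝ T i)) _ = _
    rw [real_inner_smul_left, inner_horizontalPart_left, real_inner_self_eq_norm_sq]
    ring
  have htr : ∑ i, ‖(stdOrthonormalBasis ℝ T i : AmbientSpace n m).fst‖ ^ 2 = (n : ℝ) - 1 :=
    sum_norm_fst_stdOrthonormalBasis hr hp
  change ∑ i, secondFundamentalForm (sphereTimesSphere n m r)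
      (fun q => (-r⁻¹) • horizontalPart n m q) p
      (stdOrthonormalBasis ℝ T i : AmbientSpace n m) (stdOrthonormalBasis ℝ T i) = _
  simp only [hterm, ← Finset.mul_sum, htr]
  ring

/-- The standard basis of `ℝ^n × ℝ^(m+1)`. -/
noncomputable def ambientBasis (n m : ℕ) :
    OrthonormalBasis (Fin n ⊕ Fin (m + 1)) ℝ (AmbientSpace n m) :=
  (EuclideanSpace.basisFun (Fin n) ℝ).prod (EuclideanSpace.basisFun (Fin (m + 1)) ℝ)

theorem inner_ambientBasis_inl (i : Fin n) (p : AmbientSpace n m) :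
    inner ℝ (ambientBasis n m (Sum.inl i)) p = p.fst i := by
  rw [inner_ambient]
  simp [ambientBasis, EuclideanSpace.inner_single_left]

theorem inner_ambientBasis_inr (j : Fin (m + 1)) (p : AmbientSpace n m) :
    inner ℝ (ambientBasis n m (Sum.inr j)) p = p.snd j := by
  rw [inner_ambient]
  simp [ambientBasis, EuclideanSpace.inner_single_left]

theorem coordinateSpheres_ambientBasis {r : ℝ} (hr : 0 < r) :
    coordinateSpheres (ambientBasis n m) r = sphereTimesSphere n m r := by
  ext p
  simp only [coordinateSpheres, MvPolynomial.spherePoints, Set.mem_ofPred_eq,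
    inner_ambientBasis_inl, inner_ambientBasis_inr, sphereTimesSphere,
    ← EuclideanSpace.real_norm_sq_eq]
  rw [sq_eq_sq₀ (norm_nonneg _) hr.le, pow_eq_one_iff_of_nonneg (norm_nonneg _) two_ne_zero]

/-- Lagrange's identity. With g tangent to the sphere at x the last term vanishes, which explains
the factors 1/(2r²) and 1/2 in `gradientProduct`. -/
theorem sum_mul_sub_mul_sq {ι : Type*} [Fintype ι] (x g : ι → ℝ) :
    ∑ i, ∑ j, (x i * g j - x j * g i) * (x i * g j - x j * g i)
      = 2 * ((∑ i, x i ^ 2) * (∑ i, g i ^ 2)) - 2 * (∑ i, x i * g i) ^ 2 := by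
  have h : ∀ i j, (x i * g j - x j * g i) * (x i * g j - x j * g i)
      = x i ^ 2 * g j ^ 2 + g i ^ 2 * x j ^ 2 - 2 * ((x i * g i) * (x j * g j)) :=
    fun i j => by ring
  simp only [h, Finset.sum_sub_distrib, Finset.sum_add_distrib, ← Finset.mul_sum,
    ← Finset.sum_mul]
  ring

/-- Rotation fields are tangent, so the derivative of the extension `v` along them is the inner
product with the surface gradient of `u`. -/
theorem norm_surfaceGradient_sq {r : ℝ} (hr : 0 < r) {p : AmbientSpace n m}
    (hp : p ∈ sphereTimesSphere n m r) {u v : AmbientSpace n m → ℝ}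
    (huv : ∀ q ∈ sphereTimesSphere n m r, u q = v q) (hv : DifferentiableAt ℝ v p) :
    ‖surfaceGradient (sphereTimesSphere n m r) u p‖ ^ 2
      = gradientProduct (ambientBasis n m) r v v p := by
  set S := sphereTimesSphere n m r with hS
  set G := surfaceGradient S u p with hG
  have hGT : inner ℝ G.fst p.fst = 0 ∧ inner ℝ G.snd p.snd = 0 :=
    (mem_tangentSpaceAt_sphereTimesSphere hr hp).1 (surfaceGradient_mem S u p)
  have hu : HasFDerivWithinAt u (fderiv ℝ v p) S p :=
    hv.hasFDerivAt.hasFDerivWithinAt.congr huv (huv p hp)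
  have hrot : ∀ s t : Fin n ⊕ Fin (m + 1), s.isLeft = t.isLeft →
      rotationDeriv (ambientBasis n m) s t v p
        = inner ℝ (ambientBasis n m s) p * inner ℝ (ambientBasis n m t) G
          - inner ℝ (ambientBasis n m t) p * inner ℝ (ambientBasis n m s) G := by
    intro s t hst
    rw [rotationDeriv, ← inner_surfaceGradient hu, rotationGenerator_apply, inner_sub_right,
      real_inner_smul_right, real_inner_smul_right, real_inner_comm (ambientBasis n m t),
      real_inner_comm (ambientBasis n m s)]
    rw [mem_tangentSpaceAt_sphereTimesSphere hr hp]
    rcases s with i | i <;> rcases t with j | j <;> simp at hst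
    · simp only [inner_ambientBasis_inl, rotationGenerator_apply]
      simp [ambientBasis, inner_sub_left, real_inner_smul_left, EuclideanSpace.inner_single_left,
        mul_comm]
    · simp only [inner_ambientBasis_inr, rotationGenerator_apply]
      simp [ambientBasis, inner_sub_left, real_inner_smul_left, EuclideanSpace.inner_single_left,
        mul_comm]
  have hinner : ∀ {k : ℕ} (x y : EuclideanSpace ℝ (Fin k)), ∑ i, x i * y i = inner ℝ y x := by
    intro k x y
    simp [PiLp.inner_apply]
  have hl := fun i j => hrot (Sum.inl i) (Sum.inl j) rfl
  have hr' := fun i j => hrot (Sum.inr i) (Sum.inr j) rfl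
  simp only [gradientProduct, hl, hr', inner_ambientBasis_inl, inner_ambientBasis_inr]
  rw [sum_mul_sub_mul_sq p.fst G.fst, sum_mul_sub_mul_sq p.snd G.snd, hinner, hinner, hGT.1, hGT.2,
    ← EuclideanSpace.real_norm_sq_eq, ← EuclideanSpace.real_norm_sq_eq,
    ← EuclideanSpace.real_norm_sq_eq, ← EuclideanSpace.real_norm_sq_eq, hp.1, hp.2,
    WithLp.prod_norm_sq_eq_of_L2]
  field_simp
  ring

theorem indexForm_sphereTimesSphere {r : ℝ} (hr : 0 < r) {N : AmbientSpace n m → AmbientSpace n m}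
    (hN : IsUnitNormalField (euclideanTimesSphere n m) (sphereTimesSphere n m r) N) (k : ℕ)
    {u v : AmbientSpace n m → ℝ} (huv : ∀ q ∈ sphereTimesSphere n m r, u q = v q)
    (hv : ∀ q ∈ sphereTimesSphere n m r, DifferentiableAt ℝ v q) :
    indexForm k (euclideanTimesSphere n m) (sphereTimesSphere n m r) N u
      = ∫ p, (gradientProduct (ambientBasis n m) r v v p - ((n : ℝ) - 1) / r ^ 2 * v p ^ 2)
        ∂(volumeMeasure k (sphereTimesSphere n m r)) := by
  have hmeas : MeasurableSet (sphereTimesSphere n m r) := by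
    rw [← coordinateSpheres_ambientBasis hr]
    exact (isCompact_coordinateSpheres _ r).measurableSet
  rw [indexForm]
  refine setIntegral_congr_fun hmeas fun p hp => ?_
  obtain ⟨s, -, hNp, -⟩ := unitNormalField_sphereTimesSphere hr hN hp
  have hric : ricci (euclideanTimesSphere n m) p (N p) = 0 := by
    refine ricci_euclideanTimesSphere (sphereTimesSphere_subset r hp) ?_
    rw [hNp]
    change (s / r) • (0 : EuclideanSpace ℝ (Fin (m + 1))) = 0
    rw [smul_zero]
  simp only [norm_surfaceGradient_sq hr hp huv (hv p hp), hric,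
    normSqSecondFundamentalForm_sphereTimesSphere hr hN hp, zero_add, huv p hp]

end Ambient

/-! ### Local parametrization and projection of a sphere -/

section SphereChart

variable {F : Type*} [NormedAddCommGroup F] [InnerProductSpace ℝ F]

/-- The central projection of the tangent space at `x` to the sphere through `x`. -/
noncomputable def sphereChart (x : F) (v : (ℝ ∙ x)ᗮ) : F := (‖x‖ / ‖x + v‖) • (x + (v : F))

theorem contDiffAt_sphereChart {x : F} (hx : x ≠ 0) : ContDiffAt ℝ 1 (sphereChart x) 0 := by
  have h1 : ContDiffAt ℝ 1 (fun v : (ℝ ∙ x)ᗮ => x + (v : F)) 0 :=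
    (contDiff_const.add (ℝ ∙ x)ᗮ.subtypeL.contDiff).contDiffAt
  have h0 : x + ((0 : (ℝ ∙ x)ᗮ) : F) ≠ 0 := by simpa using hx
  exact (contDiffAt_const.div (h1.norm ℝ h0) (norm_ne_zero_iff.2 h0)).smul h1

/-- A local inverse of `sphereChart`. -/
noncomputable def sphereChartInverse (x q : F) : (ℝ ∙ x)ᗮ :=
  (ℝ ∙ x)ᗮ.orthogonalProjectionOnto ((‖x‖ ^ 2 / inner ℝ q x) • q - x)

theorem sphereChartInverse_self {x : F} (hx : x ≠ 0) : sphereChartInverse x x = 0 := by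
  rw [sphereChartInverse, real_inner_self_eq_norm_sq, div_self (by simpa using hx), one_smul,
    sub_self, map_zero]

theorem continuousAt_sphereChartInverse {x : F} (hx : x ≠ 0) :
    ContinuousAt (sphereChartInverse x) x := by
  refine (ContinuousLinearMap.continuous _).continuousAt.comp ?_
  refine ((continuousAt_const.div (by fun_prop) ?_).smul continuousAt_id).sub continuousAt_const
  simpa using hx

theorem sphereChart_sphereChartInverse {x q : F} (hq : ‖q‖ = ‖x‖) (hqx : 0 < inner ℝ q x) :
    sphereChart x (sphereChartInverse x q) = q := by
  have hx : 0 < ‖x‖ := by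
    rw [norm_pos_iff]
    rintro rfl
    simp at hqx
  have hmem : (‖x‖ ^ 2 / inner ℝ q x) • q - x ∈ (ℝ ∙ x)ᗮ := by
    rw [Submodule.mem_orthogonal_singleton_iff_inner_left, inner_sub_left, real_inner_smul_left,
      div_mul_cancel₀ _ hqx.ne', real_inner_self_eq_norm_sq, sub_self]
  have hcoe : (sphereChartInverse x q : F) = (‖x‖ ^ 2 / inner ℝ q x) • q - x :=
    (Submodule.starProjection_eq_self_iff.2 hmem)
  rw [sphereChart, hcoe, add_sub_cancel, norm_smul, smul_smul, hq, Real.norm_of_nonneg (by positivity)]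
  have : ‖x‖ / (‖x‖ ^ 2 / inner ℝ q x * ‖x‖) * (‖x‖ ^ 2 / inner ℝ q x) = 1 := by
    field_simp
  rw [this, one_smul]

/-- The sphere covers a ball of its tangent space under orthogonal projection; this bounds its
measure from below. -/
theorem exists_mem_sphere_orthogonalProjection_eq {x : F} {v : (ℝ ∙ x)ᗮ}
    (hv : ‖v‖ < ‖x‖) : ∃ q : F, ‖q‖ = ‖x‖ ∧ (ℝ ∙ x)ᗮ.orthogonalProjectionOnto q = v := by
  have hx : 0 < ‖x‖ := (norm_nonneg v).trans_lt hv
  have hvx : inner ℝ (v : F) x = 0 := Submodule.mem_orthogonal_singleton_iff_inner_left.1 v.2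
  have h0 : 0 ≤ 1 - ‖v‖ ^ 2 / ‖x‖ ^ 2 := by
    rw [sub_nonneg, div_le_one (by positivity)]
    gcongr
  refine ⟨Real.sqrt (1 - ‖v‖ ^ 2 / ‖x‖ ^ 2) • x + v, ?_, ?_⟩
  · rw [← sq_eq_sq₀ (norm_nonneg _) (norm_nonneg _), norm_add_sq_real, real_inner_smul_left,
      real_inner_comm, hvx, norm_smul, mul_pow, Real.norm_eq_abs, sq_abs, Real.sq_sqrt h0,
      Submodule.coe_norm]
    field_simp
    ring
  · rw [map_add, map_smul, Submodule.orthogonalProjectionOnto_mem_subspace_eq_self]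
    have : (ℝ ∙ x)ᗮ.orthogonalProjectionOnto x = 0 := by
      rw [Submodule.orthogonalProjectionOnto_eq_zero_iff, Submodule.orthogonal_orthogonal]
      exact Submodule.mem_span_singleton_self x
    rw [this, smul_zero, zero_add]

end SphereChart

/-! ### Invariance, finiteness and positivity of the volume -/

section Measure

variable {n m : ℕ}

theorem measurableSet_sphereTimesSphere {r : ℝ} (hr : 0 < r) :
    MeasurableSet (sphereTimesSphere n m r) := by
  rw [← coordinateSpheres_ambientBasis hr]
  exact (isCompact_coordinateSpheres _ r).measurableSet

theorem isInvariantOnSpheres_volumeMeasure {r : ℝ} (hr : 0 < r) (k : ℕ) :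
    IsInvariantOnSpheres (ambientBasis n m) r (volumeMeasure k (sphereTimesSphere n m r)) where
  ae_mem := by
    rw [coordinateSpheres_ambientBasis hr]
    exact ae_restrict_mem (measurableSet_sphereTimesSphere hr)
  invariant := fun e he => by
    rw [coordinateSpheres_ambientBasis hr] at he
    have h := (e.toIsometryEquiv.measurePreserving_euclideanHausdorffMeasure k).restrict_preimage
      (measurableSet_sphereTimesSphere (n := n) (m := m) hr)
    have he' : e.toIsometryEquiv ⁻¹' sphereTimesSphere n m r = sphereTimesSphere n m r := he
    rw [he'] at h
    exact h

theorem finrank_orthogonal_prod (hn : 0 < n) {x : EuclideanSpace ℝ (Fin n)}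
    {y : EuclideanSpace ℝ (Fin (m + 1))} (hx : x ≠ 0) (hy : y ≠ 0) :
    Module.finrank ℝ ((ℝ ∙ x)ᗮ × (ℝ ∙ y)ᗮ) = n - 1 + m := by
  have h1 : Module.finrank ℝ (EuclideanSpace ℝ (Fin n)) = (n - 1) + 1 := by
    rw [finrank_euclideanSpace_fin]; omega
  have h2 : Module.finrank ℝ (EuclideanSpace ℝ (Fin (m + 1))) = m + 1 :=
    finrank_euclideanSpace_fin
  have := Fact.mk h1
  have := Fact.mk h2
  rw [Module.finrank_prod, Submodule.finrank_orthogonal_span_singleton (n := n - 1) hx,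
    Submodule.finrank_orthogonal_span_singleton (n := m) hy]

/-- The product of two sphere charts. -/
noncomputable def productSphereChart (p : AmbientSpace n m)
    (v : (ℝ ∙ p.fst)ᗮ × (ℝ ∙ p.snd)ᗮ) : AmbientSpace n m :=
  (WithLp.prodContinuousLinearEquiv 2 ℝ (EuclideanSpace ℝ (Fin n))
    (EuclideanSpace ℝ (Fin (m + 1)))).symm (sphereChart p.fst v.1, sphereChart p.snd v.2)

theorem contDiffAt_productSphereChart {p : AmbientSpace n m} (hx : p.fst ≠ 0) (hy : p.snd ≠ 0) :
    ContDiffAt ℝ 1 (productSphereChart p) 0 := by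
  have h1 : ContDiffAt ℝ 1 (fun v : (ℝ ∙ p.fst)ᗮ × (ℝ ∙ p.snd)ᗮ => sphereChart p.fst v.1) 0 :=
    ContDiffAt.comp (g := sphereChart p.fst) (f := Prod.fst) 0 (contDiffAt_sphereChart hx)
      contDiffAt_fst
  have h2 : ContDiffAt ℝ 1 (fun v : (ℝ ∙ p.fst)ᗮ × (ℝ ∙ p.snd)ᗮ => sphereChart p.snd v.2) 0 :=
    ContDiffAt.comp (g := sphereChart p.snd) (f := Prod.snd) 0 (contDiffAt_sphereChart hy)
      contDiffAt_snd
  exact (ContinuousLinearEquiv.comp_contDiffAt_iff (WithLp.prodContinuousLinearEquiv 2 ℝ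
    (EuclideanSpace ℝ (Fin n)) (EuclideanSpace ℝ (Fin (m + 1)))).symm).2 (h1.prodMk h2)

theorem image_productSphereChart_mem_nhdsWithin {r : ℝ} (hr : 0 < r) {p : AmbientSpace n m}
    (hp : p ∈ sphereTimesSphere n m r) {ε : ℝ} (hε : 0 < ε) :
    productSphereChart p '' Metric.closedBall 0 ε ∈ 𝓝[sphereTimesSphere n m r] p := by
  have hx : p.fst ≠ 0 := by rw [← norm_pos_iff, hp.1]; exact hr
  have hy : p.snd ≠ 0 := by rw [← norm_pos_iff, hp.2]; exact one_pos
  have hc1 : ContinuousAt (fun q : AmbientSpace n m => sphereChartInverse p.fst q.fst) p :=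
    ContinuousAt.comp (g := sphereChartInverse p.fst) (f := fun q : AmbientSpace n m => q.fst)
      (continuousAt_sphereChartInverse hx) (by fun_prop)
  have hc2 : ContinuousAt (fun q : AmbientSpace n m => sphereChartInverse p.snd q.snd) p :=
    ContinuousAt.comp (g := sphereChartInverse p.snd) (f := fun q : AmbientSpace n m => q.snd)
      (continuousAt_sphereChartInverse hy) (by fun_prop)
  have hev1 : ∀ᶠ q : AmbientSpace n m in 𝓝 p,
      (sphereChartInverse p.fst q.fst, sphereChartInverse p.snd q.snd) ∈
        Metric.closedBall (0 : (ℝ ∙ p.fst)ᗮ × (ℝ ∙ p.snd)ᗮ) ε := by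
    refine (hc1.prodMk hc2).eventually_mem ?_
    rw [sphereChartInverse_self hx, sphereChartInverse_self hy]
    exact Metric.closedBall_mem_nhds _ hε
  have hev2 : ∀ᶠ q : AmbientSpace n m in 𝓝 p, 0 < inner ℝ q.fst p.fst := by
    refine ContinuousAt.eventually_lt (by fun_prop) (by fun_prop) ?_
    rw [real_inner_self_eq_norm_sq]; positivity
  have hev3 : ∀ᶠ q : AmbientSpace n m in 𝓝 p, 0 < inner ℝ q.snd p.snd := by
    refine ContinuousAt.eventually_lt (by fun_prop) (by fun_prop) ?_
    rw [real_inner_self_eq_norm_sq]; positivity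
  filter_upwards [nhdsWithin_le_nhds hev1, nhdsWithin_le_nhds hev2, nhdsWithin_le_nhds hev3,
    self_mem_nhdsWithin] with q h1 h2 h3 hq
  refine ⟨_, h1, ?_⟩
  rw [productSphereChart, sphereChart_sphereChartInverse (hq.1.trans hp.1.symm) h2,
    sphereChart_sphereChartInverse (hq.2.trans hp.2.symm) h3]
  rfl

/-- Each point has a neighbourhood in the hypersurface covered by the Lipschitz image of a ball of
dimension n - 1 + m; compactness does the rest. -/
theorem hausdorffMeasure_sphereTimesSphere_lt_top (hn : 0 < n) {r : ℝ} (hr : 0 < r) :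
    (μH[(n - 1 + m : ℕ)] : Measure (AmbientSpace n m)) (sphereTimesSphere n m r) < ⊤ := by
  have hcomp : IsCompact (sphereTimesSphere n m r) := by
    rw [← coordinateSpheres_ambientBasis hr]
    exact isCompact_coordinateSpheres _ r
  refine hcomp.measure_lt_top_of_nhdsWithin fun p hp => ?_
  have hx : p.fst ≠ 0 := by rw [← norm_pos_iff, hp.1]; exact hr
  have hy : p.snd ≠ 0 := by rw [← norm_pos_iff, hp.2]; exact one_pos
  obtain ⟨K, t, ht, hK⟩ := (contDiffAt_productSphereChart hx hy).exists_lipschitzOnWith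
  obtain ⟨ε, hε, hball⟩ := Metric.nhds_basis_closedBall.mem_iff.1 ht
  refine ⟨_, image_productSphereChart_mem_nhdsWithin hr hp hε, ?_⟩
  refine lt_of_le_of_lt ((hK.mono hball).hausdorffMeasure_image_le (Nat.cast_nonneg _)) ?_
  refine ENNReal.mul_lt_top (ENNReal.rpow_lt_top_of_nonneg (Nat.cast_nonneg _)
    ENNReal.coe_ne_top) ?_
  rw [← finrank_orthogonal_prod hn hx hy]
  exact (isCompact_closedBall _ ε).measure_lt_top

/-- The orthogonal projection to one tangent space is Lipschitz and its image contains a nonempty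
open set, so a null hypersurface is impossible. -/
theorem hausdorffMeasure_sphereTimesSphere_ne_zero (hn : 0 < n) {r : ℝ} (hr : 0 < r) :
    (μH[(n - 1 + m : ℕ)] : Measure (AmbientSpace n m)) (sphereTimesSphere n m r) ≠ 0 := by
  intro h0
  let x : EuclideanSpace ℝ (Fin n) := EuclideanSpace.single ⟨0, hn⟩ r
  let y : EuclideanSpace ℝ (Fin (m + 1)) := EuclideanSpace.single 0 1
  have hxn : ‖x‖ = r := by simp [x, abs_of_pos hr]
  have hyn : ‖y‖ = 1 := by simp [y]
  have hx : x ≠ 0 := by rw [← norm_pos_iff, hxn]; exact hr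
  have hy : y ≠ 0 := by rw [← norm_pos_iff, hyn]; exact one_pos
  let W := (ℝ ∙ x)ᗮ × (ℝ ∙ y)ᗮ
  have hW : Module.finrank ℝ W = n - 1 + m := finrank_orthogonal_prod hn hx hy
  let P : AmbientSpace n m →L[ℝ] W :=
    ((ℝ ∙ x)ᗮ.orthogonalProjectionOnto ∘L WithLp.fstL 2 ℝ _ _).prod
      ((ℝ ∙ y)ᗮ.orthogonalProjectionOnto ∘L WithLp.sndL 2 ℝ _ _)
  have hsub : Metric.ball (0 : (ℝ ∙ x)ᗮ) r ×ˢ Metric.ball (0 : (ℝ ∙ y)ᗮ) 1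
      ⊆ P '' sphereTimesSphere n m r := by
    rintro ⟨v, w⟩ ⟨hv, hw⟩
    rw [mem_ball_zero_iff] at hv hw
    obtain ⟨q, hq, rfl⟩ := exists_mem_sphere_orthogonalProjection_eq (hv.trans_eq hxn.symm)
    obtain ⟨q', hq', rfl⟩ := exists_mem_sphere_orthogonalProjection_eq (hw.trans_eq hyn.symm)
    exact ⟨WithLp.toLp 2 (q, q'), ⟨hq.trans hxn, hq'.trans hyn⟩, rfl⟩
  have h1 := P.lipschitz.hausdorffMeasure_image_le (Nat.cast_nonneg (n - 1 + m))
    (sphereTimesSphere n m r)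
  rw [h0, mul_zero, ← hW] at h1
  have h2 : 0 < (μH[Module.finrank ℝ W] : Measure W)
      (Metric.ball (0 : (ℝ ∙ x)ᗮ) r ×ˢ Metric.ball (0 : (ℝ ∙ y)ᗮ) 1) :=
    (Metric.isOpen_ball.prod Metric.isOpen_ball).measure_pos _
      ⟨(0, 0), Metric.mem_ball_self hr, Metric.mem_ball_self one_pos⟩
  exact absurd ((measure_mono hsub).trans h1) (not_le.2 h2)

theorem isFiniteMeasure_volumeMeasure (hn : 0 < n) {r : ℝ} (hr : 0 < r) :
    IsFiniteMeasure (volumeMeasure (n - 1 + m) (sphereTimesSphere n m r)) := by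
  refine ⟨?_⟩
  rw [volumeMeasure, Measure.restrict_apply_univ, Measure.euclideanHausdorffMeasure_def,
    Measure.smul_apply, ENNReal.smul_def, smul_eq_mul]
  exact ENNReal.mul_lt_top ENNReal.coe_lt_top (hausdorffMeasure_sphereTimesSphere_lt_top hn hr)

theorem volumeMeasure_univ_ne_zero (hn : 0 < n) {r : ℝ} (hr : 0 < r) :
    volumeMeasure (n - 1 + m) (sphereTimesSphere n m r) Set.univ ≠ 0 := by
  rw [volumeMeasure, Measure.restrict_apply_univ, Measure.euclideanHausdorffMeasure_def,
    Measure.smul_apply, ENNReal.smul_def, smul_eq_mul]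
  exact mul_ne_zero (by simpa using
    Measure.addHaarScalarFactor_volume_hausdorffMeasure_ne_zero (n - 1 + m))
    (hausdorffMeasure_sphereTimesSphere_ne_zero hn hr)

end Measure

/-! ### The stability criterion -/

section Stability

variable {n m : ℕ}

/-- The retraction of a neighbourhood of `S^(n-1)(r) × S^m` to it. -/
noncomputable def sphereRetraction (n m : ℕ) (r : ℝ) (p : AmbientSpace n m) : AmbientSpace n m :=
  (WithLp.prodContinuousLinearEquiv 2 ℝ (EuclideanSpace ℝ (Fin n))
    (EuclideanSpace ℝ (Fin (m + 1)))).symm ((r / ‖p.fst‖) • p.fst, (1 / ‖p.snd‖) • p.snd)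

/-- The points of `ℝ^n × ℝ^(m+1)` with nonzero components. -/
def nonzeroComponents (n m : ℕ) : Set (AmbientSpace n m) := {p | p.fst ≠ 0 ∧ p.snd ≠ 0}

theorem isOpen_nonzeroComponents : IsOpen (nonzeroComponents n m) :=
  (isOpen_ne_fun (by fun_prop) continuous_const).inter
    (isOpen_ne_fun (by fun_prop) continuous_const)

theorem sphereTimesSphere_subset_nonzeroComponents {r : ℝ} (hr : 0 < r) :
    sphereTimesSphere n m r ⊆ nonzeroComponents n m := fun p hp =>
  ⟨by rw [← norm_pos_iff, hp.1]; exact hr, by rw [← norm_pos_iff, hp.2]; exact one_pos⟩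

theorem contDiffOn_sphereRetraction (r : ℝ) :
    ContDiffOn ℝ ∞ (sphereRetraction n m r) (nonzeroComponents n m) := by
  have h1 : ContDiffOn ℝ ∞ (fun p : AmbientSpace n m => p.fst) (nonzeroComponents n m) :=
    (WithLp.fstL 2 ℝ (EuclideanSpace ℝ (Fin n))
      (EuclideanSpace ℝ (Fin (m + 1)))).contDiff.contDiffOn
  have h2 : ContDiffOn ℝ ∞ (fun p : AmbientSpace n m => p.snd) (nonzeroComponents n m) :=
    (WithLp.sndL 2 ℝ (EuclideanSpace ℝ (Fin n))
      (EuclideanSpace ℝ (Fin (m + 1)))).contDiff.contDiffOn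
  exact (ContinuousLinearEquiv.comp_contDiffOn_iff (WithLp.prodContinuousLinearEquiv 2 ℝ
    (EuclideanSpace ℝ (Fin n)) (EuclideanSpace ℝ (Fin (m + 1)))).symm).2
    (((contDiffOn_const.div (h1.norm ℝ fun p hp => hp.1)
      fun p hp => norm_ne_zero_iff.2 hp.1).smul h1).prodMk
    ((contDiffOn_const.div (h2.norm ℝ fun p hp => hp.2)
      fun p hp => norm_ne_zero_iff.2 hp.2).smul h2))

theorem mapsTo_sphereRetraction {r : ℝ} (hr : 0 < r) :
    Set.MapsTo (sphereRetraction n m r) (nonzeroComponents n m) (sphereTimesSphere n m r) := by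
  intro p hp
  have h1 := norm_pos_iff.2 hp.1
  have h2 := norm_pos_iff.2 hp.2
  constructor
  · change ‖(r / ‖p.fst‖) • p.fst‖ = r
    rw [norm_smul, Real.norm_of_nonneg (by positivity), div_mul_cancel₀ _ h1.ne']
  · change ‖(1 / ‖p.snd‖) • p.snd‖ = 1
    rw [norm_smul, Real.norm_of_nonneg (by positivity), div_mul_cancel₀ _ h2.ne']

theorem sphereRetraction_of_mem {r : ℝ} (hr : 0 < r) {p : AmbientSpace n m}
    (hp : p ∈ sphereTimesSphere n m r) : sphereRetraction n m r p = p := by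
  rw [sphereRetraction, hp.1, hp.2, div_self hr.ne', div_one, one_smul, one_smul]
  rfl

theorem integral_gradientProduct_sub {r : ℝ} (hr : 0 < r) (hn : 0 < n) {U : Set (AmbientSpace n m)}
    (hU : IsOpen U) (hSU : sphereTimesSphere n m r ⊆ U) {v : AmbientSpace n m → ℝ}
    (hv : ContDiffOn ℝ 1 v U) (c : ℝ) :
    ∫ p, (gradientProduct (ambientBasis n m) r v v p - c * v p ^ 2)
        ∂(volumeMeasure (n - 1 + m) (sphereTimesSphere n m r))
      = ∫ p, gradientProduct (ambientBasis n m) r v v p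
          ∂(volumeMeasure (n - 1 + m) (sphereTimesSphere n m r))
        - c * ∫ p, v p ^ 2 ∂(volumeMeasure (n - 1 + m) (sphereTimesSphere n m r)) := by
  have := isFiniteMeasure_volumeMeasure (m := m) hn hr
  have hμ := isInvariantOnSpheres_volumeMeasure (n := n) (m := m) hr (n - 1 + m)
  have hSU' : coordinateSpheres (ambientBasis n m) r ⊆ U :=
    (coordinateSpheres_ambientBasis hr).trans_subset hSU
  have h1 := hμ.integrable (continuousOn_gradientProduct (ambientBasis n m) r hU hSU' hv hv)
  have h2 : Integrable (fun p => v p ^ 2) (volumeMeasure (n - 1 + m) (sphereTimesSphere n m r)) :=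
    hμ.integrable ((hv.continuousOn.mono hSU').pow 2)
  rw [integral_sub h1 (h2.const_mul c), integral_const_mul]

theorem isStable_sphereTimesSphere (hn : 1 < n) (hm : 0 < m) {r : ℝ} (hr : 0 < r)
    (h : ((n : ℝ) - 1) / r ^ 2 ≤ m) :
    IsStable (n - 1 + m) (euclideanTimesSphere n m) (sphereTimesSphere n m r) := by
  intro N hN u hu
  have hn1 : (1 : ℝ) < n := by exact_mod_cast hn
  have := isFiniteMeasure_volumeMeasure (m := m) (zero_lt_one.trans hn) hr
  have hμ := isInvariantOnSpheres_volumeMeasure (n := n) (m := m) hr (n - 1 + m)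
  have hSU : coordinateSpheres (ambientBasis n m) r ⊆ nonzeroComponents n m :=
    (coordinateSpheres_ambientBasis hr).trans_subset (sphereTimesSphere_subset_nonzeroComponents hr)
  -- An admissible `u` is smooth only along the hypersurface; the retraction extends it to an open
  -- neighbourhood, where full derivatives exist.
  set v : AmbientSpace n m → ℝ := u ∘ sphereRetraction n m r with hv
  have huv : ∀ q ∈ sphereTimesSphere n m r, u q = v q := fun q hq => by
    rw [hv, Function.comp_apply, sphereRetraction_of_mem hr hq]
  have hvU : ContDiffOn ℝ 1 v (nonzeroComponents n m) :=
    (hu.smooth.comp (contDiffOn_sphereRetraction r) (mapsTo_sphereRetraction hr)).of_le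
      (by exact_mod_cast le_top)
  have hv0 : ∫ p, v p ∂(volumeMeasure (n - 1 + m) (sphereTimesSphere n m r)) = 0 := by
    rw [← hu.mean_zero]
    exact setIntegral_congr_fun (measurableSet_sphereTimesSphere hr) fun p hp => (huv p hp).symm
  rw [indexForm_sphereTimesSphere hr hN _ huv fun q hq =>
    (hvU.differentiableOn one_ne_zero).differentiableAt
      (isOpen_nonzeroComponents.mem_nhds (sphereTimesSphere_subset_nonzeroComponents hr hq)),
    integral_gradientProduct_sub hr (zero_lt_one.trans hn) isOpen_nonzeroComponents
      (sphereTimesSphere_subset_nonzeroComponents hr) hvU, sub_nonneg]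
  -- Here l = (n-1)/r²: one bound on `l` is an equality, the other is `h`.
  refine hμ.poincare ?_ ?_ hr.ne' ?_ ?_ ?_ isOpen_nonzeroComponents hSU hvU hv0
  · rw [Fintype.card_fin]; omega
  · rw [Fintype.card_fin]; omega
  · exact div_nonneg (by linarith) (by positivity)
  · rw [Fintype.card_fin]
  · rw [Fintype.card_fin]; push_cast; linarith

open MvPolynomial in
theorem eval_productLaplacian_X_inr {ι κ : Type*} [Fintype ι] [Fintype κ] {r : ℝ} (hr : r ≠ 0)
    (j : κ) {x : ι ⊕ κ → ℝ} (hx : x ∈ spherePoints ι κ r) :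
    eval x (productLaplacian r (X (Sum.inr j)))
      = ((Fintype.card κ : ℝ) - 1) * eval x (X (Sum.inr j)) := by
  classical
  have h := eval_productLaplacian_monomial hr (Finsupp.single (Sum.inr j : ι ⊕ κ) 1) 1 hx
  have h1 : degreeLeft (Finsupp.single (Sum.inr j : ι ⊕ κ) 1) = 0 := by
    simp [degreeLeft]
  have h2 : degreeRight (Finsupp.single (Sum.inr j : ι ⊕ κ) 1) = 1 := by
    simp [degreeRight, Finsupp.single_apply]
  have h3 : flatLaplacian (X (Sum.inr j) : MvPolynomial (ι ⊕ κ) ℝ) = 0 := by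
    simp [flatLaplacian, pderiv_X, Pi.single_apply, apply_ite]
  change eval x (productLaplacian r (X (Sum.inr j))) = bidegreeEigenvalue ι κ r _ _ *
    eval x (X (Sum.inr j)) - eval x (flatLaplacian (X (Sum.inr j))) at h
  rw [h, h1, h2, h3, map_zero, sub_zero, bidegreeEigenvalue]
  push_cast
  ring

open MvPolynomial in
-- The rotation derivative of x_i x_j is x_i² - x_j², and it integrates to zero.
theorem IsInvariantOnSpheres.integral_sq_eq {E ι κ : Type*} [NormedAddCommGroup E]
    [InnerProductSpace ℝ E] [Fintype ι] [Fintype κ] [FiniteDimensional ℝ E] [MeasurableSpace E]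
    [BorelSpace E] {b : OrthonormalBasis (ι ⊕ κ) ℝ E} {r : ℝ} {μ : Measure E} [IsFiniteMeasure μ]
    (hμ : IsInvariantOnSpheres b r μ) (i j : κ) :
    ∫ p, polynomialFunction b (X (Sum.inr i)) p ^ 2 ∂μ
      = ∫ p, polynomialFunction b (X (Sum.inr j)) p ^ 2 ∂μ := by
  classical
  by_cases hij : i = j
  · rw [hij]
  have h := hμ.integral_rotationDeriv isOpen_univ (Set.subset_univ _)
    (s := Sum.inr i) (t := Sum.inr j) rfl
    (contDiff_polynomialFunction b (X (Sum.inr i) * X (Sum.inr j))).contDiffOn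
  rw [rotationDeriv_polynomialFunction] at h
  have hint : ∀ k : κ, Integrable (fun p => polynomialFunction b (X (Sum.inr k)) p ^ 2) μ :=
    fun k => hμ.integrable
      ((contDiff_polynomialFunction b _ (k := 0)).continuous.pow 2).continuousOn
  rw [← sub_eq_zero, ← integral_sub (hint i) (hint j), ← h]
  refine integral_congr_ae (Eventually.of_forall fun p => ?_)
  simp only [polynomialFunction, rotationDerivation_apply, Derivation.leibniz, pderiv_X_self,
    smul_eq_mul, map_sub, map_mul, map_add, eval_X, map_one]
  rw [pderiv_X_of_ne (by simpa using Ne.symm hij), pderiv_X_of_ne (by simpa using hij)]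
  simp only [map_zero]
  ring

open MvPolynomial in
theorem IsInvariantOnSpheres.card_mul_integral_sq {E ι κ : Type*} [NormedAddCommGroup E]
    [InnerProductSpace ℝ E] [Fintype ι] [Fintype κ] [FiniteDimensional ℝ E] [MeasurableSpace E]
    [BorelSpace E] {b : OrthonormalBasis (ι ⊕ κ) ℝ E} {r : ℝ} {μ : Measure E} [IsFiniteMeasure μ]
    (hμ : IsInvariantOnSpheres b r μ) (j : κ) :
    Fintype.card κ * ∫ p, polynomialFunction b (X (Sum.inr j)) p ^ 2 ∂μ = μ.real Set.univ := by
  have hint : ∀ k : κ, Integrable (fun p => polynomialFunction b (X (Sum.inr k)) p ^ 2) μ :=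
    fun k => hμ.integrable
      ((contDiff_polynomialFunction b _ (k := 0)).continuous.pow 2).continuousOn
  have h : ∫ p, ∑ i : κ, polynomialFunction b (X (Sum.inr i)) p ^ 2 ∂μ = ∫ _, (1 : ℝ) ∂μ :=
    integral_congr_ae (hμ.ae_mem.mono fun p hp => by
      simpa only [polynomialFunction, eval_X] using hp.2)
  rw [integral_finsetSum _ fun i _ => hint i,
    Finset.sum_congr rfl fun i _ => hμ.integral_sq_eq i j] at h
  simpa using h

open MvPolynomial in
theorem not_isStable_sphereTimesSphere (hn : 0 < n) (hm : 0 < m) {r : ℝ} (hr : 0 < r)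
    (h : (m : ℝ) < ((n : ℝ) - 1) / r ^ 2) :
    ¬ IsStable (n - 1 + m) (euclideanTimesSphere n m) (sphereTimesSphere n m r) := by
  intro hstable
  have hfin := isFiniteMeasure_volumeMeasure (m := m) hn hr
  have hμ := isInvariantOnSpheres_volumeMeasure (n := n) (m := m) hr (n - 1 + m)
  set P : MvPolynomial (Fin n ⊕ Fin (m + 1)) ℝ := X (Sum.inr 0) with hP
  set u := polynomialFunction (ambientBasis n m) P with hu
  have huU : ∀ {k}, ContDiff ℝ k u := contDiff_polynomialFunction _ _
  have heig : ∀ x ∈ spherePoints (Fin n) (Fin (m + 1)) r,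
      eval x (productLaplacian r P) = (m : ℝ) * eval x P := fun x hx => by
    rw [hP, eval_productLaplacian_X_inr hr.ne' 0 hx, Fintype.card_fin]
    push_cast
    ring
  have hpos : 0 < ∫ p, u p ^ 2 ∂(volumeMeasure (n - 1 + m) (sphereTimesSphere n m r)) := by
    have h1 := hμ.card_mul_integral_sq 0
    have h2 : 0 < (volumeMeasure (n - 1 + m) (sphereTimesSphere n m r)).real Set.univ :=
      ENNReal.toReal_pos (volumeMeasure_univ_ne_zero hn hr) (measure_ne_top _ _)
    rw [← h1] at h2
    exact pos_of_mul_pos_right h2 (Nat.cast_nonneg _)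
  -- Testing the weak eigenvalue equation with the constant 1 gives 0 = m ∫ u.
  have hmean : ∫ p, u p ∂(volumeMeasure (n - 1 + m) (sphereTimesSphere n m r)) = 0 := by
    have h1 := hμ.integral_gradientProduct isOpen_univ (Set.subset_univ _)
      (contDiffOn_const (c := (1 : ℝ))) heig
    have h2 : ∀ p, gradientProduct (ambientBasis n m) r (fun _ => (1 : ℝ)) u p = 0 := fun p => by
      simp [gradientProduct, rotationDeriv]
    simp only [← hu, h2, integral_zero, one_mul] at h1
    exact (mul_eq_zero.1 h1.symm).resolve_left (Nat.cast_ne_zero.2 hm.ne')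
  have hadm : IsAdmissible (n - 1 + m) (sphereTimesSphere n m r) u :=
    ⟨huU.contDiffOn, ⟨_, subset_rfl, by
      rw [← coordinateSpheres_ambientBasis hr]
      exact isCompact_coordinateSpheres _ r, fun p hp => absurd hp.1 hp.2⟩, hmean⟩
  have hQ := hstable _ (isUnitNormalField_sphereTimesSphere hr) u hadm
  rw [indexForm_sphereTimesSphere hr (isUnitNormalField_sphereTimesSphere hr) _ (fun _ _ => rfl)
    fun q _ => (huU (k := 1)).differentiable one_ne_zero q,
    integral_gradientProduct_sub hr hn isOpen_univ (Set.subset_univ _) huU.contDiffOn,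
    hμ.integral_gradientProduct isOpen_univ (Set.subset_univ _) huU.contDiffOn heig] at hQ
  simp only [← hu, ← sq] at hQ
  nlinarith

theorem not_isStable_sphereTimesSphere_iff (hn : 1 < n) (hm : 0 < m) {r : ℝ} (hr : 0 < r) :
    ¬ IsStable (n - 1 + m) (euclideanTimesSphere n m) (sphereTimesSphere n m r) ↔
      (m : ℝ) < ((n : ℝ) - 1) / r ^ 2 :=
  ⟨fun h => not_le.1 fun h' => h (isStable_sphereTimesSphere hn hm hr h'),
    not_isStable_sphereTimesSphere (zero_lt_one.trans hn) hm hr⟩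

end Stability

theorem lemma5p2 (n m : ℕ) (hn : 1 < n) (hm : 1 < m) :
    (∀ h : ℝ, 0 < h →
      HasConstantMeanCurvature (euclideanTimesSphere n m)
        (sphereTimesSphere n m (((n : ℝ) - 1) / h)) h ∧
      (¬ IsStable (n - 1 + m) (euclideanTimesSphere n m)
          (sphereTimesSphere n m (((n : ℝ) - 1) / h)) ↔
        Real.sqrt ((m : ℝ) * ((n : ℝ) - 1)) < h)) ∧
    (∀ r : ℝ, 0 < r →
      HasConstantMeanCurvature (euclideanTimesSphere n m)
        (sphereTimesSphere n m r) (((n : ℝ) - 1) / r) ∧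
      (¬ IsStable (n - 1 + m) (euclideanTimesSphere n m) (sphereTimesSphere n m r) ↔
        r < Real.sqrt ((n : ℝ) - 1) / Real.sqrt (m : ℝ))) := by
  have hn1 : (0 : ℝ) < (n : ℝ) - 1 := sub_pos.2 (by exact_mod_cast hn)
  have hm0 : (0 : ℝ) < m := by exact_mod_cast zero_lt_one.trans hm
  refine ⟨fun h hh => ⟨?_, ?_⟩, fun r hr => ⟨hasConstantMeanCurvature_sphereTimesSphere hr, ?_⟩⟩
  · have := hasConstantMeanCurvature_sphereTimesSphere (n := n) (m := m) (div_pos hn1 hh)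
    rwa [div_div_cancel₀ hn1.ne'] at this
  -- For r = (n-1)/h the criterion m < (n-1)/r² reads m (n-1) < h².
  · rw [not_isStable_sphereTimesSphere_iff hn (zero_lt_one.trans hm) (div_pos hn1 hh),
      Real.sqrt_lt' hh, lt_div_iff₀ (by positivity), div_pow, ← mul_div_assoc,
      div_lt_iff₀ (by positivity), sq ((n : ℝ) - 1), ← mul_assoc, mul_comm ((n : ℝ) - 1) (h ^ 2),
      mul_lt_mul_iff_left₀ hn1]
  · rw [not_isStable_sphereTimesSphere_iff hn (zero_lt_one.trans hm) hr,
      lt_div_iff₀ (Real.sqrt_pos.2 hm0), Real.lt_sqrt (by positivity), mul_pow,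
      Real.sq_sqrt hm0.le, lt_div_iff₀ (by positivity), mul_comm]
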